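/- **Setting.** Let $n,d\ge 2$, $k\ge 0$ be integers, $0<\varepsilon<1$, $0<\delta<1$. Let $(x_1,y_1),\dots,(x_n,y_n)\in\mathbb R^d\times\mathbb R$ be i.i.d. copies of $(x,y)$ with $y=\langle\theta^*,x\rangle+\zeta$, $\mathbb E x=0$, $\mathbb E[\zeta\mid x]=0$, $\|\theta^*\|_0\le k$, $\|\theta^*\|_1\le 1$. Let $\Sigma$ be the covariance matrix of $x$. Assume, for constants $\kappa_\infty,\kappa_x,\sigma>0$, $M$ and $p>1$: (i) $\|\Sigma w\|_\infty\ge\kappa_\infty\|w\|_\infty$ for all $w\in\mathbb R^d$, and $\|\Sigma^{-1/2}x\|_{\psi_2}\le\kappa_x$; (ii) $x$ is $\sigma^2$-sub-Gaussian, i.e. $\mathbb E e^{t\langle x,u\rangle}\le e^{\sigma^2t^2/2}$ for all unit vectors $u$ and all $t\in\mathbb R$; (iii) $\mathbb E|y|^{2p}\le M$. Here $\|Z\|_{\psi_2}=\inf\{c>0:\mathbb E e^{Z^2/c^2}\le 2\}$ for scalar $Z$, and for a random vector it is the supremum of $\|\langle Z,u\rangle\|_{\psi_2}$ over unit vectors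 $u$. **Algorithm 1** (parameters $\varepsilon,\delta,r,\tau_1,\tau_2,\lambda_n$). User $i$ computes $\bar x_i=x_i\min\{1,r/\|x_i\|_2\}$, $\tilde x_{ij}=\operatorname{sgn}(x_{ij})\min\{|x_{ij}|,\tau_1\}$, $\tilde y_i=\operatorname{sgn}(y_i)\min\{|y_i|,\tau_2\}$, and releases $\bar x_i\bar x_i^T+n_{1,i}$ and $\tilde x_i\tilde y_i+n_{2,i}$. Here $n_{1,i}$ is a symmetric matrix whose upper-triangular entries (diagonal included) are i.i.d. $N\big(0,\tfrac{32r^4\log(2.5/\delta)}{\varepsilon^2}\big)$ and $n_{2,i}\sim N\big(0,\tfrac{32d\tau_1^2\tau_2^2\log(2.5/\delta)}{\varepsilon^2}I_d\big)$, all noises being independent of each other and of the data. With $\dot\Sigma_{\bar X\bar X}$ and $\dot\Sigma_{\tilde X\tilde Y}$ the averages over $i$ of the released matrices and vectors, the output is $\hat\theta=S_{\lambda_n}\big(\dot\Sigma_{\bar X\bar X}^{-1}\dot\Sigma_{\tilde X\tilde Y}\big)$, where $[S_\lambda(u)]_j=\operatorname{sgn}(u_j)\max(|u_j|-\lambda,0)$.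 **Theorem.** There are absolute constants $a_0>0$ and $m\in\mathbb N$ such that the following holds for all $a_1,a_2\ge a_0$, all $\sigma,\kappa_\infty,\kappa_x,M,p$ as above, and all $\delta_0<1$, $s\ge1$, $c>0$. There is $b_0>0$ such that for every $b\ge b_0$ there are $C,C'>0$ (all depending only on the constants listed so far) with the following property. Let $n,d,k,\varepsilon,\delta,\theta^*$ and the law of $(x,y)$ be as in the setting, with $\delta\le\delta_0$ and $$n\ \ge\ C'\,\Big(\log\frac{nd}{\delta}\Big)^{m}\max\Big\{\frac{d^4}{\varepsilon^2\kappa_\infty},\ \frac{\|\Sigma\|_2^4\,d^3}{\varepsilon^2\lambda_{\min}^2(\Sigma)}\Big\}.$$ Run Algorithm 1 with $$\tau_1=a_1\sigma\sqrt{\log n},\qquad r=a_2\sigma\sqrt{d\log n},\qquad \lambda_n=b\,d\log n\,\sqrt{\log\tfrac1\delta}\,\Big(\frac{\log d}{n\varepsilon^2}\Big)^{\frac{p-1}{2p}},$$ and with $\tau_2=\big(\frac{n\varepsilon^2}{\log d}\big)^{\frac1{2p}}$ or, more generally, any $\tau_2$ between this value and $s$ times it (in particular $\tau_2=\big(\frac{n}{\log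 d}\big)^{\frac1{2p}}$ is allowed when $\varepsilon\ge s^{-p}$). Then, with probability at least $1-d^{-c}$ over the data and the noise, $$\|\hat\theta-\theta^*\|_2\ \le\ C\,d\log n\,\sqrt{k\log\tfrac1\delta}\,\Big(\frac{\log d}{n\varepsilon^2}\Big)^{\frac{p-1}{2p}}.$$ -/

import Mathlib

open MeasureTheory ProbabilityTheory
open scoped ENNReal NNReal Matrix

noncomputable section

namespace LDPSparse

/-- Feature vectors and parameters live in `ℝ^d` with its Euclidean norm. -/
abbrev Vec (d : ℕ) : Type := EuclideanSpace ℝ (Fin d)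

/-! ### Sub-Gaussian quantities -/

/-- The norm `‖X‖_{ψ₂} = inf {c > 0 : E exp (X² / c²) ≤ 2}`, equal to `∞` if no such `c` exists. -/
def psiTwoNorm {Ω : Type*} [MeasurableSpace Ω] (μ : Measure Ω) (X : Ω → ℝ) : ℝ≥0∞ :=
  ⨅ (c : ℝ≥0) (_ : 0 < c)
    (_ : ∫⁻ ω, ENNReal.ofReal (Real.exp (X ω ^ 2 / (c : ℝ) ^ 2)) ∂μ ≤ 2), (c : ℝ≥0∞)

/-- The `ψ₂` norm of a random vector: the supremum of the norms of its one-dimensional marginals. -/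
def psiTwoNormVec {Ω : Type*} [MeasurableSpace Ω] {d : ℕ} (μ : Measure Ω) (X : Ω → Vec d) :
    ℝ≥0∞ :=
  ⨆ (u : Vec d) (_ : ‖u‖ = 1), psiTwoNorm μ (fun ω => inner ℝ (X ω) u)

/-- A random vector is sub-Gaussian with variance `σ²` if `E exp (t ⟨X, u⟩) ≤ exp (σ² t² / 2)`
for all unit vectors `u` and all real `t`. -/
def IsSubGaussianVec {Ω : Type*} [MeasurableSpace Ω] {d : ℕ} (μ : Measure Ω) (X : Ω → Vec d)
    (σ : ℝ) : Prop :=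
  ∀ u : Vec d, ‖u‖ = 1 → HasSubgaussianMGF (fun ω => inner ℝ (X ω) u) (Real.toNNReal (σ ^ 2)) μ

/-! ### Matrices -/

/-- `A^{-1/2}` for a symmetric positive definite matrix. -/
def invSqrt {d : ℕ} (A : Matrix (Fin d) (Fin d) ℝ) : Matrix (Fin d) (Fin d) ℝ :=
  cfc (fun t : ℝ => (Real.sqrt t)⁻¹) A

/-- The spectral norm `‖A‖₂`. -/
def specNorm {d : ℕ} (A : Matrix (Fin d) (Fin d) ℝ) : ℝ :=
  ‖Matrix.toEuclideanCLM (n := Fin d) (𝕜 := ℝ) A‖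

/-- The minimal (real) eigenvalue of a matrix. -/
def lamMin {d : ℕ} (A : Matrix (Fin d) (Fin d) ℝ) : ℝ := sInf (spectrum ℝ A)

/-! ### The statistical model.  `P` is the law of one pair `(x, y)`. -/

/-- The covariance matrix of the feature vector. -/
def covMat {d : ℕ} (P : Measure (Vec d × ℝ)) : Matrix (Fin d) (Fin d) ℝ :=
  Matrix.of fun a b => covariance (fun z : Vec d × ℝ => z.1 a) (fun z => z.1 b) P

/-- The sparse linear model `y = ⟨θ, x⟩ + ζ` with `E x = 0`, `E[ζ | x] = 0` and `‖θ‖₀ ≤ k`;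
the noise is `ζ = y - ⟨θ, x⟩`. -/
structure IsSparseLinearModel {d : ℕ} (P : Measure (Vec d × ℝ)) (θ : Vec d) (k : ℕ) : Prop where
  integrable_fst : ∀ j, Integrable (fun z : Vec d × ℝ => z.1 j) P
  mean_zero : ∀ j, ∫ z, z.1 j ∂P = 0
  integrable_noise : Integrable (fun z : Vec d × ℝ => z.2 - inner ℝ θ z.1) P
  condExp_noise :
    P[fun z : Vec d × ℝ => z.2 - inner ℝ θ z.1 |
      MeasurableSpace.comap (Prod.fst : Vec d × ℝ → Vec d) inferInstance] =ᵐ[P] 0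
  sparse : (Finset.univ.filter fun j => θ j ≠ 0).card ≤ k

/-- `‖θ‖₁ ≤ 1`, `‖S w‖_∞ ≥ κ∞ ‖w‖_∞` for every `w`, and `‖S^{-1/2} x‖_{ψ₂} ≤ κx`, where `S` is the
covariance matrix of `x`. -/
structure IsWellConditioned {d : ℕ} (P : Measure (Vec d × ℝ)) (θ : Vec d) (κinf κx : ℝ) :
    Prop where
  l1_le : ∑ j, |θ j| ≤ 1
  sup_lower : ∀ w : Fin d → ℝ, κinf * ‖w‖ ≤ ‖covMat P *ᵥ w‖
  psi_le : psiTwoNormVec P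
    (fun z : Vec d × ℝ => WithLp.toLp 2 (invSqrt (covMat P) *ᵥ (fun j => z.1 j)))
      ≤ ENNReal.ofReal κx

/-- Sub-Gaussian features with variance `σ²`, and `E |y|^{2p} ≤ M`. -/
structure IsHeavyTailed {d : ℕ} (P : Measure (Vec d × ℝ)) (σ p M : ℝ) : Prop where
  subGaussian : IsSubGaussianVec P (fun z : Vec d × ℝ => z.1) σ
  moment : ∫⁻ z, ENNReal.ofReal (|z.2| ^ (2 * p)) ∂P ≤ ENNReal.ofReal M

/-! ### The non-interactive algorithm -/

/-- `sgn(a) min {|a|, τ}`. -/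
def shrink (τ a : ℝ) : ℝ := Real.sign a * min |a| τ

/-- `x min {1, r / ‖x‖₂}`. -/
def clip {d : ℕ} (r : ℝ) (x : Vec d) : Vec d := min 1 (r / ‖x‖) • x

/-- The soft-thresholding operator `S_lam`. -/
def softThreshold {d : ℕ} (lam : ℝ) (u : Fin d → ℝ) : Vec d :=
  WithLp.toLp 2 fun j => Real.sign (u j) * max (|u j| - lam) 0

/-- Noise of one user.  The first component holds the free entries of a symmetric matrix, one for
each unordered pair of indices; the second is a vector. -/
abbrev UserNoise (d : ℕ) : Type := (Sym2 (Fin d) → ℝ) × (Fin d → ℝ)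

/-- The parameters of the algorithm. -/
structure Params where
  /-- privacy parameter `ε` -/
  eps : ℝ
  /-- privacy parameter `δ` -/
  del : ℝ
  /-- radius of the Euclidean clipping -/
  r : ℝ
  /-- shrinkage level of the feature coordinates -/
  tau1 : ℝ
  /-- shrinkage level of the responses -/
  tau2 : ℝ
  /-- soft-thresholding level -/
  lam : ℝ

/-- Law of the noise of one user: the entries of the upper triangle of the symmetric matrix are
i.i.d. `N(0, 32 r⁴ log(2.5/δ) / ε²)`, and independently the entries of the vector are i.i.d.
`N(0, 32 d τ₁² τ₂² log(2.5/δ) / ε²)`. -/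
def userNoiseLaw (d : ℕ) (q : Params) : Measure (UserNoise d) :=
  (Measure.pi fun _ : Sym2 (Fin d) =>
      gaussianReal 0 (Real.toNNReal (32 * q.r ^ 4 * Real.log (2.5 / q.del) / q.eps ^ 2))).prod
    (Measure.pi fun _ : Fin d =>
      gaussianReal 0 (Real.toNNReal
        (32 * (d : ℝ) * q.tau1 ^ 2 * q.tau2 ^ 2 * Real.log (2.5 / q.del) / q.eps ^ 2)))

/-- The message about `x xᵀ` that a user releases. -/
def releaseXX {d : ℕ} (q : Params) (z : Vec d × ℝ) (w : UserNoise d) :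
    Matrix (Fin d) (Fin d) ℝ :=
  Matrix.of fun a b => clip q.r z.1 a * clip q.r z.1 b + w.1 s(a, b)

/-- The message about `x y` that a user releases. -/
def releaseXY {d : ℕ} (q : Params) (z : Vec d × ℝ) (w : UserNoise d) : Fin d → ℝ :=
  fun j => shrink q.tau1 (z.1 j) * shrink q.tau2 z.2 + w.2 j

/-- The output of the algorithm on the data set `D` with noise `W`. -/
def thetaPriv {n d : ℕ} (q : Params) (D : Fin n → Vec d × ℝ) (W : Fin n → UserNoise d) : Vec d :=
  softThreshold q.lam
    (((n : ℝ)⁻¹ • ∑ i, releaseXX q (D i) (W i))⁻¹ *ᵥ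
      ((n : ℝ)⁻¹ • ∑ i, releaseXY q (D i) (W i)))

/-- Joint law of `n` i.i.d. samples from `P` and of the independent noises of the `n` users. -/
def runLaw (n : ℕ) {d : ℕ} (P : Measure (Vec d × ℝ)) (q : Params) :
    Measure ((Fin n → Vec d × ℝ) × (Fin n → UserNoise d)) :=
  (Measure.pi fun _ : Fin n => P).prod (Measure.pi fun _ : Fin n => userNoiseLaw d q)

end LDPSparse

end

noncomputable section

namespace LDPSparse

/-! ### Deterministic analysis of the estimator -/

/-! Let `A` and `v` be the averaged releases, `Σ` the covariance matrix and `u = A⁻¹v`. If every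
`|u_j - θ_j|` is at most `λ`, soft thresholding annihilates the coordinates where `θ` vanishes and
moves the others by at most `λ`, so the Euclidean error is at most `2λ√k`
(`norm_softThreshold_sub_le`). It remains to bound `u - θ = A⁻¹(v - Aθ)` in sup norm. An entrywise
error `κ/(2d)` in `A` costs at most half of the lower bound `‖Σw‖_∞ ≥ κ‖w‖_∞`, so `A` is invertible
and its inverse expands sup norms by at most `2/κ`. Moreover `v - Aθ = (v - Σθ) - (A - Σ)θ`, and
`‖θ‖₁ ≤ 1` turns an entrywise bound on `A - Σ` into a sup-norm bound without loss in `d`.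

Because `E[ζ | x] = 0`, `Σθ = E[xy]`, so both errors are deviations of averages, each split into
fluctuation and bias. The clipped products are bounded and the noise is Gaussian, so fluctuations
are sub-Gaussian and a union bound over the entries suffices (`runLaw_not_isTypical_le`). Clipping
`x` at a level of order `√(log n)` per coordinate has polynomially small bias
(`integral_sq_tail_le`); truncating `y` costs about `τ₁ / τ₂^(p-1)` by the `2p`-th moment.

With `G = log d / (nε²)`, the fluctuations of `v` scale as `τ₂√G` and the truncation bias as
`τ₂^(-(p-1))`. The choice `τ₂ = G^(-1/(2p))` balances them at `G^((p-1)/(2p))` (`rate_identities`),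
and the sample size forces the matrix error below `κ/(2d)` (`sample_size_bounds`). -/

theorem abs_softThreshold_sub_le {lam u t : ℝ} (h : |u - t| ≤ lam) :
    |Real.sign u * max (|u| - lam) 0 - t| ≤ if t = 0 then 0 else 2 * lam := by
  have hl : 0 ≤ lam := (abs_nonneg _).trans h
  split_ifs with ht
  · subst ht
    rw [sub_zero] at h
    rw [max_eq_right (by linarith)]
    simp
  · have h2 : |Real.sign u * max (|u| - lam) 0 - u| ≤ lam := by
      rcases lt_trichotomy u 0 with hu | hu | hu
      · rw [Real.sign_of_neg hu, abs_of_neg hu]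
        rcases max_cases (-u - lam) 0 with ⟨h1, h3⟩ | ⟨h1, h3⟩ <;> rw [h1, abs_le] <;>
          constructor <;> linarith
      · subst hu
        simpa using hl
      · rw [Real.sign_of_pos hu, abs_of_pos hu]
        rcases max_cases (u - lam) 0 with ⟨h1, h3⟩ | ⟨h1, h3⟩ <;> rw [h1, abs_le] <;>
          constructor <;> linarith
    calc _ ≤ |Real.sign u * max (|u| - lam) 0 - u| + |u - t| := abs_sub_le _ _ _
      _ ≤ 2 * lam := by linarith

theorem norm_softThreshold_sub_le {d k : ℕ} {lam : ℝ} {u : Fin d → ℝ} {θ : Vec d}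
    (hlam : 0 ≤ lam) (hk : (Finset.univ.filter fun j => θ j ≠ 0).card ≤ k)
    (h : ∀ j, |u j - θ j| ≤ lam) :
    ‖softThreshold lam u - θ‖ ≤ 2 * lam * Real.sqrt k := by
  rw [EuclideanSpace.norm_eq]
  refine Real.sqrt_le_iff.2 ⟨by positivity, ?_⟩
  calc ∑ j, ‖(softThreshold lam u - θ) j‖ ^ 2
      ≤ ∑ j, (if θ j ≠ 0 then (2 * lam) ^ 2 else 0) := by
        refine Finset.sum_le_sum fun j _ => ?_
        have := abs_softThreshold_sub_le (h j)
        have h2 : ‖(softThreshold lam u - θ) j‖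
            = |Real.sign (u j) * max (|u j| - lam) 0 - θ j| := by
          simp [softThreshold]
        rw [h2]
        by_cases h3 : θ j = 0
        · rw [if_pos h3] at this
          rw [le_antisymm this (abs_nonneg _), if_neg (not_not.2 h3)]
          simp
        · rw [if_neg h3] at this
          rw [if_pos h3]
          gcongr
    _ = ((Finset.univ.filter fun j => θ j ≠ 0).card : ℝ) * (2 * lam) ^ 2 := by
        rw [← Finset.sum_filter, Finset.sum_const, nsmul_eq_mul]
    _ ≤ (k : ℝ) * (2 * lam) ^ 2 := by gcongr
    _ = (2 * lam * Real.sqrt k) ^ 2 := by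
        rw [mul_pow _ (Real.sqrt k), Real.sq_sqrt (Nat.cast_nonneg k)]; ring

theorem abs_mulVec_le {d : ℕ} {B : Matrix (Fin d) (Fin d) ℝ} {β : ℝ}
    (hB : ∀ a b, |B a b| ≤ β) (w : Fin d → ℝ) (a : Fin d) :
    |(B *ᵥ w) a| ≤ β * ∑ j, |w j| := by
  rw [Matrix.mulVec, dotProduct, Finset.mul_sum]
  refine (Finset.abs_sum_le_sum_abs _ _).trans (Finset.sum_le_sum fun j _ => ?_)
  rw [abs_mul]
  gcongr
  exact hB a j

/-- A row of `A - S` has `d` entries of size at most `κ/(2d)`, hence `A - S` has sup-norm operator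
norm at most `κ/2`; the triangle inequality keeps the other half. -/
theorem norm_le_norm_mulVec_of_close {d : ℕ} {A S : Matrix (Fin d) (Fin d) ℝ} {κ : ℝ}
    (hd : 0 < d) (hκ : 0 < κ) (hS : ∀ w : Fin d → ℝ, κ * ‖w‖ ≤ ‖S *ᵥ w‖)
    (hA : ∀ a b, |A a b - S a b| ≤ κ / (2 * d)) (w : Fin d → ℝ) :
    κ / 2 * ‖w‖ ≤ ‖A *ᵥ w‖ := by
  have h1 : ‖(A - S) *ᵥ w‖ ≤ κ / 2 * ‖w‖ := by
    refine (pi_norm_le_iff_of_nonneg (by positivity)).2 fun a => ?_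
    calc ‖((A - S) *ᵥ w) a‖ ≤ κ / (2 * d) * ∑ j, |w j| := abs_mulVec_le (B := A - S) hA w a
      _ ≤ κ / (2 * d) * ∑ _j : Fin d, ‖w‖ := by
          gcongr with j
          exact norm_le_pi_norm w j
      _ = κ / 2 * ‖w‖ := by
          have : (d : ℝ) ≠ 0 := by positivity
          simp only [Finset.sum_const, Finset.card_univ, Fintype.card_fin, nsmul_eq_mul]
          field_simp
  have h2 : S *ᵥ w = A *ᵥ w - (A - S) *ᵥ w := by rw [Matrix.sub_mulVec]; abel
  have h3 := hS w
  rw [h2] at h3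
  linarith [norm_sub_le (A *ᵥ w) ((A - S) *ᵥ w)]

theorem norm_inv_mulVec_sub_le {d : ℕ} {A : Matrix (Fin d) (Fin d) ℝ} {κ : ℝ} (hκ : 0 < κ)
    (hA : ∀ w : Fin d → ℝ, κ * ‖w‖ ≤ ‖A *ᵥ w‖) (v θ : Fin d → ℝ) :
    ‖A⁻¹ *ᵥ v - θ‖ ≤ κ⁻¹ * ‖v - A *ᵥ θ‖ := by
  have hu : IsUnit A := by
    refine Matrix.mulVec_injective_iff_isUnit.1 fun x y hxy => ?_
    have h := hA (x - y)
    rw [Matrix.mulVec_sub, sub_eq_zero.2 hxy, norm_zero] at h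
    exact sub_eq_zero.1 (norm_le_zero_iff.1 (nonpos_of_mul_nonpos_right h hκ))
  have h := hA (A⁻¹ *ᵥ v - θ)
  rw [Matrix.mulVec_sub, Matrix.mulVec_mulVec,
    Matrix.mul_nonsing_inv _ ((Matrix.isUnit_iff_isUnit_det A).1 hu), Matrix.one_mulVec] at h
  rw [inv_mul_eq_div, le_div_iff₀ hκ]
  linarith

/-! ### Concentration -/

theorem hasSubgaussianMGF_id_gaussianReal (v : ℝ≥0) :
    HasSubgaussianMGF (fun x : ℝ => x) v (gaussianReal 0 v) where
  integrable_exp_mul t := integrable_exp_mul_gaussianReal t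
  mgf_le t := by rw [mgf_fun_id_gaussianReal]; simp

/-- Chernoff bound for the sum, applied to `f` and `-f`. Keeping `t` and `η` tied only by an
inequality lets one common `t` serve all the averages in the union bound. -/
theorem measure_pi_abs_average_gt_le {α : Type*} [MeasurableSpace α] {ν : Measure α}
    [IsProbabilityMeasure ν] {f : α → ℝ} {v : ℝ≥0} (hf : HasSubgaussianMGF f v ν) {n : ℕ}
    (hn : 0 < n) (hv : 0 < v) {t η : ℝ} (hη : 0 ≤ η) (ht : 2 * v * t ≤ n * η ^ 2) :
    (Measure.pi fun _ : Fin n => ν) {D | η < |(n : ℝ)⁻¹ * ∑ i, f (D i)|}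
      ≤ ENNReal.ofReal (2 * Real.exp (-t)) := by
  have key : ∀ g : α → ℝ, HasSubgaussianMGF g v ν →
      (Measure.pi fun _ : Fin n => ν) {D | n * η ≤ ∑ i, g (D i)}
        ≤ ENNReal.ofReal (Real.exp (-t)) := by
    intro g hg
    have hind : iIndepFun (fun (i : Fin n) (D : Fin n → α) => g (D i))
        (Measure.pi fun _ : Fin n => ν) := iIndepFun_pi fun _ => hg.aemeasurable
    have hsub : ∀ i ∈ (Finset.univ : Finset (Fin n)),
        HasSubgaussianMGF (fun D : Fin n → α => g (D i)) v (Measure.pi fun _ : Fin n => ν) := by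
      intro i _
      have hp := measurePreserving_eval (fun _ : Fin n => ν) i
      refine HasSubgaussianMGF.of_map (X := g) (Y := Function.eval i) hp.measurable.aemeasurable ?_
      rwa [hp.map_eq]
    have h := HasSubgaussianMGF.measure_sum_ge_le_of_iIndepFun hind hsub
      (ε := n * η) (by positivity)
    rw [← ENNReal.ofReal_toReal (measure_ne_top _ {D : Fin n → α | n * η ≤ ∑ i, g (D i)})]
    refine ENNReal.ofReal_le_ofReal (h.trans (Real.exp_le_exp.2 ?_))
    have hn' : (0 : ℝ) < n := by positivity
    have hv' : (0 : ℝ) < v := hv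
    rw [Finset.sum_const, Finset.card_univ, Fintype.card_fin, nsmul_eq_mul, neg_div, neg_le_neg_iff]
    push_cast
    rw [le_div_iff₀ (by positivity)]
    nlinarith
  have hneg := key _ hf.neg
  calc _ ≤ (Measure.pi fun _ : Fin n => ν)
        ({D | n * η ≤ ∑ i, f (D i)} ∪ {D | n * η ≤ ∑ i, (-f) (D i)}) := by
        refine measure_mono fun D hD => ?_
        have hn' : (0 : ℝ) < n := by positivity
        simp only [Set.mem_ofPred_eq, abs_mul, abs_inv, Nat.abs_cast] at hD
        rw [lt_inv_mul_iff₀ hn', lt_abs] at hD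
        simp only [Set.mem_union, Set.mem_ofPred_eq, Pi.neg_apply, Finset.sum_neg_distrib]
        exact hD.imp le_of_lt le_of_lt
    _ ≤ ENNReal.ofReal (Real.exp (-t)) + ENNReal.ofReal (Real.exp (-t)) :=
        (measure_union_le _ _).trans (add_le_add (key f hf) hneg)
    _ = ENNReal.ofReal (2 * Real.exp (-t)) := by
        rw [← ENNReal.ofReal_add (by positivity) (by positivity), two_mul]

theorem measure_pi_abs_average_sub_integral_gt_le {α : Type*} [MeasurableSpace α] {ν : Measure α}
    [IsProbabilityMeasure ν] {f : α → ℝ} (hf : AEMeasurable f ν) {B : ℝ} (hB : 0 < B)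
    (hfB : ∀ x, |f x| ≤ B) {n : ℕ} (hn : 0 < n) {t η : ℝ} (hη : 0 ≤ η)
    (ht : 2 * B ^ 2 * t ≤ n * η ^ 2) :
    (Measure.pi fun _ : Fin n => ν)
        {D | η < |(n : ℝ)⁻¹ * ∑ i, f (D i) - ∫ x, f x ∂ν|}
      ≤ ENNReal.ofReal (2 * Real.exp (-t)) := by
  have h := hasSubgaussianMGF_of_mem_Icc hf (a := -B) (b := B)
    (ae_of_all _ fun x => abs_le.1 (hfB x))
  have hBv : ((‖B - -B‖₊ / 2) ^ 2 : ℝ≥0) = (B.toNNReal) ^ 2 := by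
    ext
    push_cast
    rw [Real.coe_toNNReal _ hB.le, Real.norm_of_nonneg (by linarith)]
    ring
  rw [hBv] at h
  have hn' : (n : ℝ) ≠ 0 := by positivity
  have h2 := measure_pi_abs_average_gt_le h hn (pow_pos (Real.toNNReal_pos.2 hB) 2) hη (t := t)
    (by push_cast; rwa [Real.coe_toNNReal _ hB.le])
  refine le_of_eq_of_le ?_ h2
  congr 1
  ext D
  simp only [Set.mem_ofPred_eq, Finset.sum_sub_distrib, Finset.sum_const, Finset.card_univ,
    Fintype.card_fin, nsmul_eq_mul, mul_sub, inv_mul_cancel_left₀ hn']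

/-! ### Truncation -/

theorem abs_shrink_le {τ : ℝ} (hτ : 0 ≤ τ) (a : ℝ) : |shrink τ a| ≤ τ := by
  rw [shrink, abs_mul, abs_of_nonneg (le_min (abs_nonneg a) hτ)]
  have h : |Real.sign a| ≤ 1 := by
    rcases Real.sign_apply_eq a with h | h | h <;> simp [h]
  calc |Real.sign a| * min |a| τ ≤ 1 * τ :=
        mul_le_mul h (min_le_right _ _) (le_min (abs_nonneg a) hτ) zero_le_one
    _ = τ := one_mul τ

theorem abs_shrink_sub_le {τ : ℝ} (hτ : 0 ≤ τ) (a : ℝ) :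
    |shrink τ a - a| ≤ if τ < |a| then |a| else 0 := by
  have hs : Real.sign a * |a| = a := by
    rcases lt_trichotomy a 0 with h | h | h
    · rw [Real.sign_of_neg h, abs_of_neg h]; ring
    · simp [h]
    · rw [Real.sign_of_pos h, abs_of_pos h]; ring
  split_ifs with h
  · rw [shrink, min_eq_right h.le]
    rcases lt_trichotomy a 0 with ha | ha | ha
    · rw [abs_of_neg ha] at *
      rw [Real.sign_of_neg ha, abs_le]
      constructor <;> linarith
    · simp [ha]
    · rw [abs_of_pos ha] at *
      rw [Real.sign_of_pos ha, abs_le]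
      constructor <;> linarith
  · rw [shrink, min_eq_left (not_lt.1 h), hs]
    simp

theorem measurable_shrink (τ : ℝ) : Measurable (shrink τ) := by
  have h : Measurable Real.sign := by
    refine Measurable.ite measurableSet_Iio measurable_const ?_
    exact Measurable.ite measurableSet_Ioi measurable_const measurable_const
  unfold shrink
  fun_prop

theorem abs_coord_le_norm {d : ℕ} (x : Vec d) (j : Fin d) : |x j| ≤ ‖x‖ :=
  PiLp.norm_apply_le x j

theorem abs_clip_apply_le {d : ℕ} {r : ℝ} (hr : 0 ≤ r) (x : Vec d) (j : Fin d) :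
    |clip r x j| ≤ r := by
  refine (abs_coord_le_norm _ j).trans ?_
  have h0 : 0 ≤ min 1 (r / ‖x‖) := le_min zero_le_one (by positivity)
  rw [clip, norm_smul, Real.norm_of_nonneg h0]
  rcases eq_or_ne x 0 with rfl | hx
  · simpa using hr
  · have hx' : 0 < ‖x‖ := norm_pos_iff.2 hx
    calc min 1 (r / ‖x‖) * ‖x‖ ≤ r / ‖x‖ * ‖x‖ := by gcongr; exact min_le_right _ _
      _ = r := div_mul_cancel₀ _ hx'.ne'

theorem measurable_clip_apply {d : ℕ} (r : ℝ) (j : Fin d) :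
    Measurable fun x : Vec d => clip r x j := by
  simp only [clip, PiLp.smul_apply, smul_eq_mul]
  have : Measurable fun x : Vec d => x j := by fun_prop
  fun_prop

/-- Clipping acts only when `‖x‖ > r`, and then changes the product by at most `‖x‖²`. Coordinates
below `τ` contribute at most `dτ² = r²/2 < ‖x‖²/2` to `‖x‖²`, so those above `τ` carry at least half
of it. The bias thus reduces to scalar tails. -/
theorem abs_clip_mul_clip_sub_le {d : ℕ} {r τ : ℝ} (hr : 0 ≤ r) (hrτ : r ^ 2 = 2 * d * τ ^ 2)
    (x : Vec d) (a b : Fin d) :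
    |clip r x a * clip r x b - x a * x b|
      ≤ 2 * ∑ j, if τ < |x j| then x j ^ 2 else 0 := by
  have hnn : ∀ j, 0 ≤ (if τ < |x j| then x j ^ 2 else 0) := fun j => by
    split_ifs <;> positivity
  have hτ0 : ∀ j, x j ^ 2 ≤ τ ^ 2 + (if τ < |x j| then x j ^ 2 else 0) := fun j => by
    split_ifs with h
    · nlinarith [sq_nonneg τ]
    · rw [add_zero]
      exact sq_le_sq' (by linarith [neg_abs_le (x j), not_lt.1 h])
        ((le_abs_self _).trans (not_lt.1 h))
  rcases le_or_gt ‖x‖ r with h | h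
  · have hc : clip r x = x := by
      rcases eq_or_ne x 0 with rfl | hx
      · simp [clip]
      · have hx' : 0 < ‖x‖ := norm_pos_iff.2 hx
        rw [clip, min_eq_left ((one_le_div hx').2 h), one_smul]
    rw [hc, sub_self, abs_zero]
    exact mul_nonneg zero_le_two (Finset.sum_nonneg fun j _ => hnn j)
  · have h0 : 0 ≤ min 1 (r / ‖x‖) := le_min zero_le_one (by positivity)
    have h1 : min 1 (r / ‖x‖) ≤ 1 := min_le_left _ _
    have h2 : |clip r x a * clip r x b - x a * x b| ≤ ‖x‖ ^ 2 := by
      simp only [clip, PiLp.smul_apply, smul_eq_mul]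
      set m := min 1 (r / ‖x‖)
      have : m * x a * (m * x b) - x a * x b = (m ^ 2 - 1) * (x a * x b) := by ring
      rw [this, abs_mul, abs_mul]
      have hm : |m ^ 2 - 1| ≤ 1 := by rw [abs_le]; constructor <;> nlinarith
      calc |m ^ 2 - 1| * (|x a| * |x b|) ≤ 1 * (‖x‖ * ‖x‖) := by
            gcongr <;> exact abs_coord_le_norm _ _
        _ = ‖x‖ ^ 2 := by ring
    have h3 : ‖x‖ ^ 2 ≤ d * τ ^ 2 + ∑ j, if τ < |x j| then x j ^ 2 else 0 := by
      rw [EuclideanSpace.real_norm_sq_eq]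
      refine (Finset.sum_le_sum fun j _ => hτ0 j).trans_eq ?_
      simp [Finset.sum_add_distrib]
    nlinarith

/-- The error of truncating `x` is separated from `y` by a weighted AM-GM inequality, with `s` free
to be tuned; for `y`, `|y| > B` gives `|y| B^(p-1) ≤ |y|^p`. A pointwise bound by integrable terms
avoids Hölder's inequality later. -/
theorem abs_shrink_mul_shrink_sub_le {τ₁ τ₂ B s p : ℝ} (hτ₁ : 0 ≤ τ₁) (hB : 0 < B) (hBτ : B ≤ τ₂)
    (hs : 0 < s) (hp : 1 < p) (x y : ℝ) :
    |shrink τ₁ x * shrink τ₂ y - x * y|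
      ≤ s * (if τ₁ < |x| then x ^ 2 else 0)
        + (s⁻¹ + τ₁ / B ^ (p - 1)) * (1 + |y| ^ (2 * p)) := by
  have hy2 : |y| ^ (2 * p) = (|y| ^ p) ^ 2 := by
    rw [mul_comm, Real.rpow_mul (abs_nonneg y), Real.rpow_two]
  have hyp : 0 ≤ |y| ^ p := Real.rpow_nonneg (abs_nonneg y) p
  have hBp : 0 < B ^ (p - 1) := Real.rpow_pos_of_pos hB _
  have hysq : |y| ^ 2 ≤ 1 + |y| ^ (2 * p) := by
    rcases le_total |y| 1 with h | h
    · nlinarith [abs_nonneg y, sq_nonneg (|y| ^ p)]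
    · have : |y| ≤ |y| ^ p := Real.self_le_rpow_of_one_le h hp.le
      rw [hy2]
      nlinarith
  have h1 : (if τ₁ < |x| then |x| else 0) * |y|
      ≤ s * (if τ₁ < |x| then x ^ 2 else 0) + s⁻¹ * (1 + |y| ^ (2 * p)) := by
    split_ifs
    · have h : |x| * |y| ≤ s * |x| ^ 2 + s⁻¹ * |y| ^ 2 := by
        have h4 : s * |x| ^ 2 + s⁻¹ * |y| ^ 2 - |x| * |y|
            = s⁻¹ * ((s * |x| - |y| / 2) ^ 2 + 3 / 4 * |y| ^ 2) := by
          field_simp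
          ring
        have : 0 ≤ s⁻¹ * ((s * |x| - |y| / 2) ^ 2 + 3 / 4 * |y| ^ 2) := by positivity
        linarith
      rw [sq_abs x] at h
      exact h.trans (by gcongr)
    · rw [zero_mul]; positivity
  have h2 : (if τ₂ < |y| then |y| else 0) ≤ (1 + |y| ^ (2 * p)) / B ^ (p - 1) := by
    rw [le_div_iff₀ hBp]
    split_ifs with h
    · have hy : 0 < |y| := hB.trans (hBτ.trans_lt h)
      calc |y| * B ^ (p - 1) ≤ |y| * |y| ^ (p - 1) := by
            gcongr
            linarith
        _ = |y| ^ p := by rw [← Real.rpow_one_add' hy.le (by linarith)]; congr 1; ring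
        _ ≤ 1 + |y| ^ (2 * p) := by rw [hy2]; nlinarith
    · rw [zero_mul]; positivity
  calc |shrink τ₁ x * shrink τ₂ y - x * y|
      = |(shrink τ₁ x - x) * y + shrink τ₁ x * (shrink τ₂ y - y)| := by congr 1; ring
    _ ≤ |shrink τ₁ x - x| * |y| + |shrink τ₁ x| * |shrink τ₂ y - y| := by
        rw [← abs_mul, ← abs_mul]; exact abs_add_le _ _
    _ ≤ (if τ₁ < |x| then |x| else 0) * |y| + τ₁ * ((1 + |y| ^ (2 * p)) / B ^ (p - 1)) := by
        gcongr
        · exact abs_shrink_sub_le hτ₁ x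
        · exact abs_shrink_le hτ₁ x
        · exact (abs_shrink_sub_le ((hB.trans_le hBτ).le) y).trans h2
    _ ≤ _ := by
        have : τ₁ * ((1 + |y| ^ (2 * p)) / B ^ (p - 1))
          = τ₁ / B ^ (p - 1) * (1 + |y| ^ (2 * p)) := by ring
        rw [this, add_mul]
        linarith

/-! ### Moments -/

theorem integral_sq_tail_le {Ω : Type*} [MeasurableSpace Ω] {μ : Measure Ω}
    {X : Ω → ℝ} {σ τ : ℝ} (hσ : 0 < σ) (hτ : 0 ≤ τ)
    (hX : HasSubgaussianMGF X (Real.toNNReal (σ ^ 2)) μ) :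
    ∫ ω, (if τ < |X ω| then X ω ^ 2 else 0) ∂μ
      ≤ 4 * σ ^ 2 * Real.exp (3 / 2 - (τ / σ) ^ 2 / 4) := by
  -- `τ/σ²` is the optimal Chernoff tilt at level `τ`; the extra `1/σ` pays for the factor `X² ≤ 2σ²
  -- exp(|X|/σ)`.
  set u : ℝ := 1 / σ + τ / σ ^ 2 with hu
  have hu0 : 0 ≤ u := by positivity
  have hmgf : ∀ t, ∫ ω, Real.exp (t * X ω) ∂μ ≤ Real.exp (σ ^ 2 * t ^ 2 / 2) := fun t => by
    have := hX.mgf_le t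
    rwa [Real.coe_toNNReal _ (sq_nonneg σ)] at this
  have hint := (hX.integrable_exp_mul u).add (hX.integrable_exp_mul (-u))
  calc ∫ ω, (if τ < |X ω| then X ω ^ 2 else 0) ∂μ
      ≤ ∫ ω, 2 * σ ^ 2 * Real.exp (-(τ / σ) ^ 2) *
          (Real.exp (u * X ω) + Real.exp (-u * X ω)) ∂μ := by
        refine integral_mono_of_nonneg (ae_of_all _ fun ω => ?_) (hint.const_mul _)
          (ae_of_all _ fun ω => ?_)
        · dsimp only
          split_ifs <;> positivity
        · dsimp only
          split_ifs with h
          · have h1 : X ω ^ 2 ≤ 2 * σ ^ 2 * Real.exp (|X ω| / σ) := by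
              have := Real.quadratic_le_exp_of_nonneg (x := |X ω| / σ) (by positivity)
              have h5 : (|X ω| / σ) ^ 2 / 2 ≤ Real.exp (|X ω| / σ) := by
                have : 0 ≤ |X ω| / σ := by positivity
                linarith
              rw [div_pow, sq_abs] at h5
              have h6 : X ω ^ 2 = 2 * σ ^ 2 * (X ω ^ 2 / σ ^ 2 / 2) := by field_simp
              rw [h6]
              gcongr
            have h2 : Real.exp (|X ω| / σ) ≤ Real.exp (-(τ / σ) ^ 2) * Real.exp (u * |X ω|) := by
              rw [← Real.exp_add, Real.exp_le_exp]
              have h7 : -(τ / σ) ^ 2 + u * |X ω| - |X ω| / σ = τ / σ ^ 2 * (|X ω| - τ) := by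
                rw [hu]; field_simp; ring
              have : 0 ≤ τ / σ ^ 2 * (|X ω| - τ) := mul_nonneg (by positivity) (by linarith)
              linarith
            have h3 : Real.exp (u * |X ω|) ≤ Real.exp (u * X ω) + Real.exp (-u * X ω) := by
              rcases abs_choice (X ω) with h8 | h8 <;> rw [h8]
              · linarith [Real.exp_pos (-u * X ω)]
              · rw [mul_neg, neg_mul]
                linarith [Real.exp_pos (u * X ω)]
            calc X ω ^ 2 ≤ 2 * σ ^ 2 * Real.exp (|X ω| / σ) := h1
              _ ≤ 2 * σ ^ 2 * (Real.exp (-(τ / σ) ^ 2) *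
                    (Real.exp (u * X ω) + Real.exp (-u * X ω))) := by
                  gcongr
                  exact h2.trans (by gcongr)
              _ = _ := by ring
          · positivity
    _ ≤ 2 * σ ^ 2 * Real.exp (-(τ / σ) ^ 2) * (2 * Real.exp (σ ^ 2 * u ^ 2 / 2)) := by
        rw [integral_const_mul,
          integral_add (hX.integrable_exp_mul u) (hX.integrable_exp_mul (-u))]
        gcongr
        have h1 := hmgf u
        have h2 := hmgf (-u)
        rw [neg_sq] at h2
        linarith
    _ = 4 * σ ^ 2 * Real.exp (-(τ / σ) ^ 2 + σ ^ 2 * u ^ 2 / 2) := by rw [Real.exp_add]; ring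
    _ ≤ 4 * σ ^ 2 * Real.exp (3 / 2 - (τ / σ) ^ 2 / 4) := by
        gcongr
        have h1 : σ ^ 2 * u ^ 2 = (1 + τ / σ) ^ 2 := by rw [hu]; field_simp
        rw [h1]
        -- With `w = τ/σ`, the inequality `-w² + (1 + w)²/2 ≤ 3/2 - w²/4` is equivalent to `(w - 2)²
        -- ≥ 0`.
        nlinarith [sq_nonneg (τ / σ - 2)]

variable {d : ℕ} {P : Measure (Vec d × ℝ)} {θ : Vec d} {σ p M : ℝ} {k : ℕ}

theorem IsHeavyTailed.coord (h : IsHeavyTailed P σ p M) (j : Fin d) :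
    HasSubgaussianMGF (fun z : Vec d × ℝ => z.1 j) (Real.toNNReal (σ ^ 2)) P := by
  have := h.subGaussian (EuclideanSpace.single j 1) (by simp)
  simpa [EuclideanSpace.inner_single_right] using this

theorem IsHeavyTailed.integrable_rpow [IsProbabilityMeasure P] (h : IsHeavyTailed P σ p M) :
    Integrable (fun z : Vec d × ℝ => 1 + |z.2| ^ (2 * p)) P := by
  have hm : Measurable fun z : Vec d × ℝ => |z.2| ^ (2 * p) := by fun_prop
  refine (integrable_const 1).add ⟨hm.aestronglyMeasurable, ?_⟩
  rw [hasFiniteIntegral_iff_ofReal (ae_of_all _ fun z => by positivity)]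
  exact h.moment.trans_lt ENNReal.ofReal_lt_top

theorem IsHeavyTailed.integral_rpow_le [IsProbabilityMeasure P] (h : IsHeavyTailed P σ p M) :
    ∫ z, (1 + |z.2| ^ (2 * p)) ∂P ≤ 1 + |M| := by
  have hm : Measurable fun z : Vec d × ℝ => |z.2| ^ (2 * p) := by fun_prop
  have hi : Integrable (fun z : Vec d × ℝ => |z.2| ^ (2 * p)) P := by
    refine (h.integrable_rpow.sub (integrable_const 1)).congr (ae_of_all _ fun z => ?_)
    simp
  rw [integral_add (integrable_const 1) hi]
  simp only [integral_const, probReal_univ, smul_eq_mul, mul_one, add_le_add_iff_left]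
  rw [integral_eq_lintegral_of_nonneg_ae (ae_of_all _ fun z => by positivity)
    hm.aestronglyMeasurable]
  refine ENNReal.toReal_le_of_le_ofReal (abs_nonneg M) (h.moment.trans ?_)
  exact ENNReal.ofReal_le_ofReal (le_abs_self M)

theorem IsHeavyTailed.memLp_snd [IsProbabilityMeasure P] (h : IsHeavyTailed P σ p M)
    (hp : 1 < p) : MemLp (fun z : Vec d × ℝ => z.2) 2 P := by
  have hm : Measurable fun z : Vec d × ℝ => z.2 := by fun_prop
  rw [memLp_two_iff_integrable_sq hm.aestronglyMeasurable]
  refine h.integrable_rpow.mono' (by fun_prop) (ae_of_all _ fun z => ?_)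
  rw [Real.norm_of_nonneg (sq_nonneg _), ← sq_abs]
  have hy2 : |z.2| ^ (2 * p) = (|z.2| ^ p) ^ 2 := by
    rw [mul_comm, Real.rpow_mul (abs_nonneg _), Real.rpow_two]
  rcases le_total |z.2| 1 with h | h
  · rw [hy2]
    nlinarith [abs_nonneg z.2, sq_nonneg (|z.2| ^ p)]
  · have : |z.2| ≤ |z.2| ^ p := Real.self_le_rpow_of_one_le h hp.le
    rw [hy2]
    nlinarith

theorem IsHeavyTailed.memLp_coord (h : IsHeavyTailed P σ p M) (j : Fin d) :
    MemLp (fun z : Vec d × ℝ => z.1 j) 2 P := by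
  simpa using (h.coord j).memLp 2

theorem covMat_apply_eq_integral [IsProbabilityMeasure P] (hm : IsSparseLinearModel P θ k)
    (h : IsHeavyTailed P σ p M) (a b : Fin d) :
    covMat P a b = ∫ z, z.1 a * z.1 b ∂P := by
  rw [covMat, Matrix.of_apply, covariance_eq_sub (h.memLp_coord a) (h.memLp_coord b),
    hm.mean_zero a, zero_mul, sub_zero]
  rfl

/-- The coordinate `x_j` is measurable with respect to `x`, so it comes out of the conditional
expectation and `E[x_j ζ] = 0`. What remains is `E[x_j ⟨θ, x⟩]`. -/
theorem integral_coord_mul_snd [IsProbabilityMeasure P] (hm : IsSparseLinearModel P θ k)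
    (h : IsHeavyTailed P σ p M) (hp : 1 < p) (j : Fin d) :
    ∫ z, z.1 j * z.2 ∂P = (covMat P *ᵥ θ.ofLp) j := by
  have hin : ∀ z : Vec d × ℝ, inner ℝ θ z.1 = ∑ b, z.1 b * θ b := fun z => by
    simp [PiLp.inner_apply]
  have hxx : ∀ b, Integrable (fun z : Vec d × ℝ => z.1 j * z.1 b) P := fun b =>
    (h.memLp_coord j).integrable_mul (h.memLp_coord b)
  have hxi : Integrable (fun z : Vec d × ℝ => z.1 j * inner ℝ θ z.1) P := by
    simp only [hin, Finset.mul_sum, ← mul_assoc]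
    exact integrable_finsetSum _ fun b _ => (hxx b).mul_const _
  have hxy : Integrable (fun z : Vec d × ℝ => z.1 j * z.2) P :=
    (h.memLp_coord j).integrable_mul (h.memLp_snd hp)
  have hxn : Integrable ((fun z : Vec d × ℝ => z.1 j) * fun z => z.2 - inner ℝ θ z.1) P := by
    convert hxy.sub hxi using 1
    ext z
    simp [mul_sub]
  have hzero : ∫ z : Vec d × ℝ, z.1 j * (z.2 - inner ℝ θ z.1) ∂P = 0 := by
    have hle : MeasurableSpace.comap (Prod.fst : Vec d × ℝ → Vec d) inferInstance
        ≤ (inferInstance : MeasurableSpace (Vec d × ℝ)) := measurable_fst.comap_le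
    have hsm : StronglyMeasurable[MeasurableSpace.comap (Prod.fst : Vec d × ℝ → Vec d)
        inferInstance] fun z : Vec d × ℝ => z.1 j := by
      have h1 : Measurable fun x : Vec d => x j := by fun_prop
      exact (h1.comp (comap_measurable Prod.fst)).stronglyMeasurable
    rw [← integral_condExp hle]
    have := condExp_mul_of_stronglyMeasurable_left hsm hxn hm.integrable_noise
    refine integral_eq_zero_of_ae (this.trans ?_)
    filter_upwards [hm.condExp_noise] with z hz
    simp [hz]
  have hsplit : ∫ z, z.1 j * z.2 ∂P = ∫ z, z.1 j * inner ℝ θ z.1 ∂P := by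
    rw [← sub_eq_zero, ← integral_sub hxy hxi]
    simpa only [mul_sub] using hzero
  rw [hsplit]
  simp only [hin, Finset.mul_sum, ← mul_assoc]
  rw [integral_finsetSum _ fun b _ => (hxx b).mul_const _]
  simp only [integral_mul_const, Matrix.mulVec, dotProduct, covMat_apply_eq_integral hm h]

theorem abs_integral_clip_mul_clip_sub_covMat_le [IsProbabilityMeasure P]
    (hm : IsSparseLinearModel P θ k) (h : IsHeavyTailed P σ p M) (hσ : 0 < σ) {r τ : ℝ}
    (hr : 0 ≤ r) (hτ : 0 ≤ τ) (hrτ : r ^ 2 = 2 * d * τ ^ 2) (a b : Fin d) :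
    |∫ z, clip r z.1 a * clip r z.1 b ∂P - covMat P a b|
      ≤ 2 * (d * (4 * σ ^ 2 * Real.exp (3 / 2 - (τ / σ) ^ 2 / 4))) := by
  have hc : Integrable (fun z : Vec d × ℝ => clip r z.1 a * clip r z.1 b) P := by
    refine Integrable.of_bound (C := r * r) ?_ (ae_of_all _ fun z => ?_)
    · exact (((measurable_clip_apply r a).comp measurable_fst).mul
        ((measurable_clip_apply r b).comp measurable_fst)).aestronglyMeasurable
    · rw [norm_mul]
      gcongr <;> exact abs_clip_apply_le hr _ _
  have hxx : Integrable (fun z : Vec d × ℝ => z.1 a * z.1 b) P :=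
    (h.memLp_coord a).integrable_mul (h.memLp_coord b)
  have ht : ∀ j, Integrable (fun z : Vec d × ℝ => if τ < |z.1 j| then z.1 j ^ 2 else 0) P :=
    fun j => by
      have h1 : Measurable fun z : Vec d × ℝ => z.1 j := by fun_prop
      refine (h.memLp_coord j).integrable_sq.mono'
        (Measurable.ite (measurableSet_lt measurable_const h1.norm) (h1.pow_const 2)
          measurable_const).aestronglyMeasurable (ae_of_all _ fun z => ?_)
      split_ifs
      · simp
      · simpa using sq_nonneg _
  rw [covMat_apply_eq_integral hm h, ← integral_sub hc hxx]
  calc |∫ z, (clip r z.1 a * clip r z.1 b - z.1 a * z.1 b) ∂P|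
      ≤ ∫ z, 2 * ∑ j, (if τ < |z.1 j| then z.1 j ^ 2 else 0) ∂P :=
        norm_integral_le_of_norm_le (f := fun z : Vec d × ℝ =>
            clip r z.1 a * clip r z.1 b - z.1 a * z.1 b)
          ((integrable_finsetSum _ fun j _ => ht j).const_mul 2)
          (ae_of_all _ fun z => abs_clip_mul_clip_sub_le hr hrτ z.1 a b)
    _ = 2 * ∑ j, ∫ z, (if τ < |z.1 j| then z.1 j ^ 2 else 0) ∂P := by
        rw [integral_const_mul, integral_finsetSum _ fun j _ => ht j]
    _ ≤ 2 * ∑ _j : Fin d, 4 * σ ^ 2 * Real.exp (3 / 2 - (τ / σ) ^ 2 / 4) := by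
        gcongr with j
        exact integral_sq_tail_le hσ hτ (h.coord j)
    _ = _ := by simp

theorem abs_integral_shrink_mul_shrink_sub_le [IsProbabilityMeasure P]
    (hm : IsSparseLinearModel P θ k) (h : IsHeavyTailed P σ p M) (hσ : 0 < σ) (hp : 1 < p)
    {τ₁ τ₂ B s : ℝ} (hτ₁ : 0 ≤ τ₁) (hB : 0 < B) (hBτ : B ≤ τ₂) (hs : 0 < s) (j : Fin d) :
    |∫ z, shrink τ₁ (z.1 j) * shrink τ₂ z.2 ∂P - (covMat P *ᵥ θ.ofLp) j|
      ≤ s * (4 * σ ^ 2 * Real.exp (3 / 2 - (τ₁ / σ) ^ 2 / 4))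
        + (s⁻¹ + τ₁ / B ^ (p - 1)) * (1 + |M|) := by
  have hτ₂ : 0 ≤ τ₂ := hB.le.trans hBτ
  have h1 : Measurable fun z : Vec d × ℝ => z.1 j := by fun_prop
  have hc : Integrable (fun z : Vec d × ℝ => shrink τ₁ (z.1 j) * shrink τ₂ z.2) P := by
    refine Integrable.of_bound (C := τ₁ * τ₂) ?_ (ae_of_all _ fun z => ?_)
    · exact (((measurable_shrink τ₁).comp h1).mul
        ((measurable_shrink τ₂).comp measurable_snd)).aestronglyMeasurable
    · rw [norm_mul]
      gcongr
      · exact abs_shrink_le hτ₁ _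
      · exact abs_shrink_le hτ₂ _
  have hxy : Integrable (fun z : Vec d × ℝ => z.1 j * z.2) P :=
    (h.memLp_coord j).integrable_mul (h.memLp_snd hp)
  have ht : Integrable (fun z : Vec d × ℝ => if τ₁ < |z.1 j| then z.1 j ^ 2 else 0) P := by
    refine (h.memLp_coord j).integrable_sq.mono'
      (Measurable.ite (measurableSet_lt measurable_const h1.norm) (h1.pow_const 2)
        measurable_const).aestronglyMeasurable (ae_of_all _ fun z => ?_)
    split_ifs
    · simp
    · simpa using sq_nonneg _
  have hBp : 0 < B ^ (p - 1) := Real.rpow_pos_of_pos hB _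
  rw [← integral_coord_mul_snd hm h hp, ← integral_sub hc hxy]
  calc |∫ z, (shrink τ₁ (z.1 j) * shrink τ₂ z.2 - z.1 j * z.2) ∂P|
      ≤ ∫ z, (s * (if τ₁ < |z.1 j| then z.1 j ^ 2 else 0)
          + (s⁻¹ + τ₁ / B ^ (p - 1)) * (1 + |z.2| ^ (2 * p))) ∂P :=
        norm_integral_le_of_norm_le (f := fun z : Vec d × ℝ =>
            shrink τ₁ (z.1 j) * shrink τ₂ z.2 - z.1 j * z.2)
          ((ht.const_mul s).add (h.integrable_rpow.const_mul _))
          (ae_of_all _ fun z => abs_shrink_mul_shrink_sub_le hτ₁ hB hBτ hs hp _ _)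
    _ = s * ∫ z, (if τ₁ < |z.1 j| then z.1 j ^ 2 else 0) ∂P
          + (s⁻¹ + τ₁ / B ^ (p - 1)) * ∫ z, (1 + |z.2| ^ (2 * p)) ∂P := by
        rw [integral_add (ht.const_mul s) (h.integrable_rpow.const_mul _), integral_const_mul,
          integral_const_mul]
    _ ≤ _ := by
        gcongr
        · exact integral_sq_tail_le hσ hτ₁ (h.coord j)
        · exact h.integral_rpow_le

/-! ### The good event -/

/-- The empirical averages of the clipped data and of the noise are close to their expectations:
up to `η` for the matrices and up to `ξ` for the vectors. -/
structure IsTypical {n d : ℕ} (P : Measure (Vec d × ℝ)) (q : Params) (η ξ : ℝ)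
    (D : Fin n → Vec d × ℝ) (W : Fin n → UserNoise d) : Prop where
  clip_close : ∀ a b, |(n : ℝ)⁻¹ * ∑ i, clip q.r (D i).1 a * clip q.r (D i).1 b
      - ∫ z, clip q.r z.1 a * clip q.r z.1 b ∂P| ≤ η
  fst_noise : ∀ a b, |(n : ℝ)⁻¹ * ∑ i, (W i).1 s(a, b)| ≤ η
  shrink_close : ∀ j, |(n : ℝ)⁻¹ * ∑ i, shrink q.tau1 ((D i).1 j) * shrink q.tau2 (D i).2
      - ∫ z, shrink q.tau1 (z.1 j) * shrink q.tau2 z.2 ∂P| ≤ ξ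
  snd_noise : ∀ j, |(n : ℝ)⁻¹ * ∑ i, (W i).2 j| ≤ ξ

instance {d : ℕ} (q : Params) : IsProbabilityMeasure (userNoiseLaw d q) := by
  unfold userNoiseLaw
  infer_instance

/-- Two families of `d²` events and two of `d`, each of probability at most `2 exp(-t)`. Data events
and noise events are estimated on their own factor of the product measure. -/
theorem runLaw_not_isTypical_le {n d : ℕ} {P : Measure (Vec d × ℝ)} [IsProbabilityMeasure P]
    {q : Params} {η ξ t : ℝ} (hn : 0 < n) (hη : 0 ≤ η) (hξ : 0 ≤ ξ) (hr : 0 < q.r)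
    (hτ₁ : 0 < q.tau1) (hτ₂ : 0 < q.tau2)
    (hv₁ : 0 < 32 * q.r ^ 4 * Real.log (2.5 / q.del) / q.eps ^ 2)
    (hv₂ : 0 < 32 * (d : ℝ) * q.tau1 ^ 2 * q.tau2 ^ 2 * Real.log (2.5 / q.del) / q.eps ^ 2)
    (h₁ : 2 * (q.r ^ 2) ^ 2 * t ≤ n * η ^ 2)
    (h₂ : 2 * (32 * q.r ^ 4 * Real.log (2.5 / q.del) / q.eps ^ 2) * t ≤ n * η ^ 2)
    (h₃ : 2 * (q.tau1 * q.tau2) ^ 2 * t ≤ n * ξ ^ 2)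
    (h₄ : 2 * (32 * (d : ℝ) * q.tau1 ^ 2 * q.tau2 ^ 2 * Real.log (2.5 / q.del) / q.eps ^ 2) * t
      ≤ n * ξ ^ 2) :
    runLaw n P q {ω | ¬ IsTypical P q η ξ ω.1 ω.2}
      ≤ ENNReal.ofReal (4 * ((d : ℝ) ^ 2 + d) * Real.exp (-t)) := by
  set e := ENNReal.ofReal (2 * Real.exp (-t)) with he
  have hfst : ∀ S : Set (Fin n → Vec d × ℝ), (Measure.pi fun _ : Fin n => P) S ≤ e →
      runLaw n P q (Prod.fst ⁻¹' S) ≤ e := fun S hS => by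
    rw [← Set.prod_univ, runLaw, Measure.prod_prod, measure_univ, mul_one]
    exact hS
  have hsnd : ∀ S : Set (Fin n → UserNoise d),
      (Measure.pi fun _ : Fin n => userNoiseLaw d q) S ≤ e →
      runLaw n P q (Prod.snd ⁻¹' S) ≤ e := fun S hS => by
    rw [← Set.univ_prod, runLaw, Measure.prod_prod, measure_univ, one_mul]
    exact hS
  have A₁ : ∀ a b : Fin d, runLaw n P q (Prod.fst ⁻¹'
      {D | η < |(n : ℝ)⁻¹ * ∑ i, clip q.r (D i).1 a * clip q.r (D i).1 b
        - ∫ z, clip q.r z.1 a * clip q.r z.1 b ∂P|}) ≤ e := fun a b => by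
    refine hfst _ (measure_pi_abs_average_sub_integral_gt_le
      (f := fun z : Vec d × ℝ => clip q.r z.1 a * clip q.r z.1 b) ?_ (pow_pos hr 2) ?_ hn hη h₁)
    · exact (((measurable_clip_apply q.r a).comp measurable_fst).mul
        ((measurable_clip_apply q.r b).comp measurable_fst)).aemeasurable
    · intro z
      rw [abs_mul, sq]
      gcongr <;> exact abs_clip_apply_le hr.le _ _
  have A₃ : ∀ j : Fin d, runLaw n P q (Prod.fst ⁻¹'
      {D | ξ < |(n : ℝ)⁻¹ * ∑ i, shrink q.tau1 ((D i).1 j) * shrink q.tau2 (D i).2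
        - ∫ z, shrink q.tau1 (z.1 j) * shrink q.tau2 z.2 ∂P|}) ≤ e := fun j => by
    refine hfst _ (measure_pi_abs_average_sub_integral_gt_le
      (f := fun z : Vec d × ℝ => shrink q.tau1 (z.1 j) * shrink q.tau2 z.2) ?_
      (mul_pos hτ₁ hτ₂) ?_ hn hξ h₃)
    · have h1 : Measurable fun z : Vec d × ℝ => z.1 j := by fun_prop
      exact (((measurable_shrink _).comp h1).mul
        ((measurable_shrink _).comp measurable_snd)).aemeasurable
    · intro z
      rw [abs_mul]
      gcongr
      · exact abs_shrink_le hτ₁.le _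
      · exact abs_shrink_le hτ₂.le _
  have A₂ : ∀ a b : Fin d, runLaw n P q (Prod.snd ⁻¹'
      {W | η < |(n : ℝ)⁻¹ * ∑ i, (W i).1 s(a, b)|}) ≤ e := fun a b => by
    refine hsnd _ (measure_pi_abs_average_gt_le (f := fun w : UserNoise d => w.1 s(a, b)) ?_ hn
      (Real.toNNReal_pos.2 hv₁) hη (by rwa [Real.coe_toNNReal _ hv₁.le]))
    refine HasSubgaussianMGF.of_map (Y := fun w : UserNoise d => w.1 s(a, b))
      (X := fun x : ℝ => x) (by fun_prop) ?_
    have hp := (measurePreserving_eval (fun _ : Sym2 (Fin d) => gaussianReal 0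
      (Real.toNNReal (32 * q.r ^ 4 * Real.log (2.5 / q.del) / q.eps ^ 2))) s(a, b)).comp
      (measurePreserving_fst (μ := Measure.pi fun _ : Sym2 (Fin d) => gaussianReal 0
        (Real.toNNReal (32 * q.r ^ 4 * Real.log (2.5 / q.del) / q.eps ^ 2)))
        (ν := Measure.pi fun _ : Fin d => gaussianReal 0 (Real.toNNReal
        (32 * (d : ℝ) * q.tau1 ^ 2 * q.tau2 ^ 2 * Real.log (2.5 / q.del) / q.eps ^ 2))))
    have hmap := hp.map_eq
    change Measure.map (fun w : UserNoise d => w.1 s(a, b)) (userNoiseLaw d q) = _ at hmap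
    rw [hmap]
    exact hasSubgaussianMGF_id_gaussianReal _
  have A₄ : ∀ j : Fin d, runLaw n P q (Prod.snd ⁻¹'
      {W | ξ < |(n : ℝ)⁻¹ * ∑ i, (W i).2 j|}) ≤ e := fun j => by
    refine hsnd _ (measure_pi_abs_average_gt_le (f := fun w : UserNoise d => w.2 j) ?_ hn
      (Real.toNNReal_pos.2 hv₂) hξ (by rwa [Real.coe_toNNReal _ hv₂.le]))
    refine HasSubgaussianMGF.of_map (Y := fun w : UserNoise d => w.2 j)
      (X := fun x : ℝ => x) (by fun_prop) ?_
    have hp := (measurePreserving_eval (fun _ : Fin d => gaussianReal 0 (Real.toNNReal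
        (32 * (d : ℝ) * q.tau1 ^ 2 * q.tau2 ^ 2 * Real.log (2.5 / q.del) / q.eps ^ 2))) j).comp
      (measurePreserving_snd (μ := Measure.pi fun _ : Sym2 (Fin d) => gaussianReal 0
        (Real.toNNReal (32 * q.r ^ 4 * Real.log (2.5 / q.del) / q.eps ^ 2)))
        (ν := Measure.pi fun _ : Fin d => gaussianReal 0 (Real.toNNReal
        (32 * (d : ℝ) * q.tau1 ^ 2 * q.tau2 ^ 2 * Real.log (2.5 / q.del) / q.eps ^ 2))))
    have hmap := hp.map_eq
    change Measure.map (fun w : UserNoise d => w.2 j) (userNoiseLaw d q) = _ at hmap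
    rw [hmap]
    exact hasSubgaussianMGF_id_gaussianReal _
  have union₁ : ∀ S : Fin d → Set ((Fin n → Vec d × ℝ) × (Fin n → UserNoise d)),
      (∀ j, runLaw n P q (S j) ≤ e) → runLaw n P q (⋃ j, S j) ≤ d * e := fun S hS => by
    refine (measure_iUnion_fintype_le _ _).trans ((Finset.sum_le_sum fun j _ => hS j).trans_eq ?_)
    simp
  have union₂ : ∀ S : Fin d → Fin d → Set ((Fin n → Vec d × ℝ) × (Fin n → UserNoise d)),
      (∀ a b, runLaw n P q (S a b) ≤ e) → runLaw n P q (⋃ a, ⋃ b, S a b) ≤ d * (d * e) :=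
    fun S hS => by
      refine (measure_iUnion_fintype_le _ _).trans
        ((Finset.sum_le_sum fun a _ => union₁ _ (hS a)).trans_eq ?_)
      simp
  calc runLaw n P q {ω | ¬ IsTypical P q η ξ ω.1 ω.2}
      -- The four omitted families are those of `A₁`, `A₂`, `A₃`, `A₄`, in this order.
      ≤ runLaw n P q (((⋃ a, ⋃ b, _) ∪ (⋃ a, ⋃ b, _)) ∪ ((⋃ j, _) ∪ (⋃ j, _))) := by
        refine measure_mono fun ω hω => ?_
        by_contra hcon
        simp only [Set.mem_union, not_or] at hcon
        obtain ⟨⟨c₁, c₂⟩, c₃, c₄⟩ := hcon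
        refine hω ⟨fun a b => not_lt.1 fun hlt => c₁ ?_, fun a b => not_lt.1 fun hlt => c₂ ?_,
          fun j => not_lt.1 fun hlt => c₃ ?_, fun j => not_lt.1 fun hlt => c₄ ?_⟩
        · exact Set.mem_iUnion.2 ⟨a, Set.mem_iUnion.2 ⟨b, hlt⟩⟩
        · exact Set.mem_iUnion.2 ⟨a, Set.mem_iUnion.2 ⟨b, hlt⟩⟩
        · exact Set.mem_iUnion.2 ⟨j, hlt⟩
        · exact Set.mem_iUnion.2 ⟨j, hlt⟩
    _ ≤ (d * (d * e) + d * (d * e)) + (d * e + d * e) :=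
        (measure_union_le _ _).trans (add_le_add
          ((measure_union_le _ _).trans (add_le_add (union₂ _ A₁) (union₂ _ A₂)))
          ((measure_union_le _ _).trans (add_le_add (union₁ _ A₃) (union₁ _ A₄))))
    _ = ENNReal.ofReal (4 * ((d : ℝ) ^ 2 + d) * Real.exp (-t)) := by
        have hd : (d : ℝ≥0∞) = ENNReal.ofReal (d : ℝ) := by simp
        rw [he, hd, ← ENNReal.ofReal_mul (by positivity), ← ENNReal.ofReal_mul (by positivity),
          ← ENNReal.ofReal_add (by positivity) (by positivity),
          ← ENNReal.ofReal_add (by positivity) (by positivity),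
          ← ENNReal.ofReal_add (by positivity) (by positivity)]
        congr 1
        ring

/-- The deterministic half of the argument: `β` and `γ` are the biases of matrix and vector, `η` and
`ξ` their fluctuations, doubled because data and noise each contribute one. -/
theorem norm_thetaPriv_sub_le_of_isTypical {n d k : ℕ} {P : Measure (Vec d × ℝ)} {q : Params}
    {θ : Vec d} {κ κx η ξ β γ : ℝ} {D : Fin n → Vec d × ℝ} {W : Fin n → UserNoise d}
    (hd : 0 < d) (hκ : 0 < κ) (hm : IsSparseLinearModel P θ k) (hw : IsWellConditioned P θ κ κx)
    (htyp : IsTypical P q η ξ D W)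
    (hβ : ∀ a b, |∫ z, clip q.r z.1 a * clip q.r z.1 b ∂P - covMat P a b| ≤ β)
    (hγ : ∀ j, |∫ z, shrink q.tau1 (z.1 j) * shrink q.tau2 z.2 ∂P - (covMat P *ᵥ θ.ofLp) j| ≤ γ)
    (hsmall : 2 * η + β ≤ κ / (2 * d))
    (hlam : 2 / κ * (2 * ξ + γ + (2 * η + β)) ≤ q.lam) :
    ‖thetaPriv q D W - θ‖ ≤ 2 * q.lam * Real.sqrt k := by
  set A : Matrix (Fin d) (Fin d) ℝ := (n : ℝ)⁻¹ • ∑ i, releaseXX q (D i) (W i) with hA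
  set v : Fin d → ℝ := (n : ℝ)⁻¹ • ∑ i, releaseXY q (D i) (W i) with hv
  have hXX : ∀ a b, |A a b - covMat P a b| ≤ 2 * η + β := fun a b => by
    have hAab : A a b = (n : ℝ)⁻¹ * ∑ i, clip q.r (D i).1 a * clip q.r (D i).1 b
        + (n : ℝ)⁻¹ * ∑ i, (W i).1 s(a, b) := by
      rw [hA, Matrix.smul_apply, Matrix.sum_apply, smul_eq_mul, ← mul_add,
        ← Finset.sum_add_distrib]
      rfl
    have h1 := abs_le.1 (htyp.clip_close a b)
    have h2 := abs_le.1 (htyp.fst_noise a b)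
    have h3 := abs_le.1 (hβ a b)
    rw [hAab, abs_le]
    constructor <;> linarith
  have hXY : ∀ j, |v j - (covMat P *ᵥ θ.ofLp) j| ≤ 2 * ξ + γ := fun j => by
    have hvj : v j = (n : ℝ)⁻¹ * ∑ i, shrink q.tau1 ((D i).1 j) * shrink q.tau2 (D i).2
        + (n : ℝ)⁻¹ * ∑ i, (W i).2 j := by
      rw [hv, Pi.smul_apply, Finset.sum_apply, smul_eq_mul, ← mul_add, ← Finset.sum_add_distrib]
      rfl
    have h1 := abs_le.1 (htyp.shrink_close j)
    have h2 := abs_le.1 (htyp.snd_noise j)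
    have h3 := abs_le.1 (hγ j)
    rw [hvj, abs_le]
    constructor <;> linarith
  have j₀ : Fin d := ⟨0, hd⟩
  have hX0 : 0 ≤ 2 * η + β := (abs_nonneg _).trans (hXX j₀ j₀)
  have hY0 : 0 ≤ 2 * ξ + γ := (abs_nonneg _).trans (hXY j₀)
  have hres : ‖v - A *ᵥ θ.ofLp‖ ≤ 2 * ξ + γ + (2 * η + β) := by
    refine (pi_norm_le_iff_of_nonneg (by positivity)).2 fun j => ?_
    have h1 : |((A - covMat P) *ᵥ θ.ofLp) j| ≤ 2 * η + β :=
      (abs_mulVec_le (B := A - covMat P) hXX _ j).trans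
        (mul_le_of_le_one_right hX0 hw.l1_le)
    have h2 : (v - A *ᵥ θ.ofLp) j
        = (v j - (covMat P *ᵥ θ.ofLp) j) - ((A - covMat P) *ᵥ θ.ofLp) j := by
      rw [Matrix.sub_mulVec]
      simp
    rw [h2, Real.norm_eq_abs]
    exact (abs_sub _ _).trans (add_le_add (hXY j) h1)
  have hinv := norm_inv_mulVec_sub_le (half_pos hκ)
    (norm_le_norm_mulVec_of_close hd hκ hw.sup_lower fun a b => (hXX a b).trans hsmall) v θ.ofLp
  have hfinal : ‖A⁻¹ *ᵥ v - θ.ofLp‖ ≤ q.lam := by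
    refine hinv.trans (le_trans ?_ hlam)
    rw [inv_div]
    gcongr
  refine norm_softThreshold_sub_le ((norm_nonneg _).trans hfinal) hm.sparse fun j => ?_
  exact (norm_le_pi_norm (A⁻¹ *ᵥ v - θ.ofLp) j).trans hfinal

/-! ### Sample size -/

/-- Multiplied by `ε²`, the hypothesis reads `(4K²/κ² + 1) L⁴ d⁴ ≤ nε²` with `L = log(nd/δ)`. The
summand `1` gives the first claim. The other gives the second after squaring, since `L⁴` dominates
`(log n)² log(1/δ) log d`. -/
theorem sample_size_bounds {n d : ℕ} {ε δ κ K : ℝ} (hn : 2 ≤ n) (hd : 2 ≤ d) (hε : 0 < ε)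
    (hδ : 0 < δ) (hδ1 : δ < 1) (hκ : 0 < κ)
    (h : (4 * K ^ 2 / κ + κ) * Real.log ((n : ℝ) * d / δ) ^ 4 * ((d : ℝ) ^ 4 / (ε ^ 2 * κ)) ≤ n) :
    (d : ℝ) ≤ n * ε ^ 2 ∧
    K * (d * Real.log n * Real.sqrt (Real.log (1 / δ)) * Real.sqrt (Real.log d / (n * ε ^ 2)))
      ≤ κ / (2 * d) := by
  have hn' : (2 : ℝ) ≤ n := by exact_mod_cast hn
  have hd' : (2 : ℝ) ≤ d := by exact_mod_cast hd
  have hd1 : (1 : ℝ) ≤ d := by linarith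
  set ℓ := Real.log (1 / δ) with hℓ
  have hℓ0 : 0 ≤ ℓ := Real.log_nonneg ((one_le_div hδ).2 hδ1.le)
  have hLn := Real.log_two_gt_d9
  have hLn' : Real.log 2 ≤ Real.log n := Real.log_le_log two_pos hn'
  have hLd' : Real.log 2 ≤ Real.log d := Real.log_le_log two_pos hd'
  have hsplit : Real.log ((n : ℝ) * d / δ) = Real.log n + Real.log d + ℓ := by
    rw [hℓ, Real.log_div (by positivity) hδ.ne', Real.log_mul (by positivity) (by positivity),
      Real.log_div one_ne_zero hδ.ne', Real.log_one]
    ring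
  rw [hsplit] at h
  set L := Real.log n + Real.log d + ℓ
  have hL1 : 1 ≤ L := by simp only [L]; linarith
  have hE : 0 < (n : ℝ) * ε ^ 2 := by positivity
  have hL4 : (1 : ℝ) ≤ L ^ 4 := one_le_pow₀ hL1
  have h2 : (4 * K ^ 2 / κ ^ 2 + 1) * (L ^ 4 * (d : ℝ) ^ 4) ≤ n * ε ^ 2 := by
    have : (4 * K ^ 2 / κ + κ) * L ^ 4 * ((d : ℝ) ^ 4 / (ε ^ 2 * κ)) * ε ^ 2
        = (4 * K ^ 2 / κ ^ 2 + 1) * (L ^ 4 * (d : ℝ) ^ 4) := by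
      field_simp
    rw [← this]
    gcongr
  have hLd4 : 0 ≤ L ^ 4 * (d : ℝ) ^ 4 := by positivity
  have hK0 : 0 ≤ 4 * K ^ 2 / κ ^ 2 := by positivity
  have h3 : L ^ 4 * (d : ℝ) ^ 4 ≤ n * ε ^ 2 := by nlinarith
  refine ⟨?_, ?_⟩
  · calc (d : ℝ) ≤ (d : ℝ) ^ 4 := le_self_pow₀ hd1 (by norm_num)
      _ ≤ L ^ 4 * (d : ℝ) ^ 4 := le_mul_of_one_le_left (by positivity) hL4
      _ ≤ _ := h3
  · rw [le_div_iff₀ (by positivity)]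
    refine le_of_sq_le_sq ?_ hκ.le
    have h4 : (K * (d * Real.log n * Real.sqrt ℓ * Real.sqrt (Real.log d / (n * ε ^ 2))) *
        (2 * d)) ^ 2
        = 4 * K ^ 2 * (d : ℝ) ^ 4 * (Real.log n * Real.log n * ℓ * Real.log d) / (n * ε ^ 2) := by
      have h5 : Real.sqrt ℓ ^ 2 = ℓ := Real.sq_sqrt hℓ0
      have h6 : Real.sqrt (Real.log d / (n * ε ^ 2)) ^ 2 = Real.log d / (n * ε ^ 2) :=
        Real.sq_sqrt (by apply div_nonneg <;> linarith)
      simp only [mul_pow, h5, h6]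
      ring
    have h7 : Real.log n * Real.log n * ℓ * Real.log d ≤ L * L * L * L := by
      gcongr <;> simp only [L] <;> linarith
    rw [h4, div_le_iff₀ hE]
    calc 4 * K ^ 2 * (d : ℝ) ^ 4 * (Real.log n * Real.log n * ℓ * Real.log d)
        ≤ 4 * K ^ 2 * (d : ℝ) ^ 4 * (L * L * L * L) := by gcongr
      _ = κ ^ 2 * (4 * K ^ 2 / κ ^ 2 * (L ^ 4 * (d : ℝ) ^ 4)) := by field_simp
      _ ≤ κ ^ 2 * (n * ε ^ 2) := by
          rw [add_mul] at h2
          exact mul_le_mul_of_nonneg_left (by linarith) (sq_nonneg κ)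

/-! ### Rates -/

theorem rate_identities {E l p : ℝ} (hl : 0 < l) (hlE : l ≤ E) (hp : 1 < p) :
    Real.sqrt (l / E) ≤ (l / E) ^ ((p - 1) / (2 * p)) ∧
    (E / l) ^ (1 / (2 * p)) * Real.sqrt (l / E) = (l / E) ^ ((p - 1) / (2 * p)) ∧
    ((E / l) ^ (1 / (2 * p))) ^ (p - 1) = ((l / E) ^ ((p - 1) / (2 * p)))⁻¹ := by
  have hE : 0 < E := hl.trans_le hlE
  have hG : 0 < l / E := div_pos hl hE
  have hG1 : l / E ≤ 1 := (div_le_one hE).2 hlE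
  have hp0 : p ≠ 0 := by positivity
  have hinv : E / l = (l / E)⁻¹ := (inv_div l E).symm
  rw [hinv, Real.inv_rpow hG.le, Real.sqrt_eq_rpow]
  refine ⟨?_, ?_, ?_⟩
  · refine Real.rpow_le_rpow_of_exponent_ge hG hG1 ?_
    rw [div_le_div_iff₀ (by positivity) (by positivity)]
    linarith
  · rw [← Real.rpow_neg hG.le, ← Real.rpow_add hG]
    congr 1
    field_simp
    ring
  · rw [Real.inv_rpow (by positivity), ← Real.rpow_mul hG.le]
    congr 2
    ring

/-- Used to absorb the clipping biases, of order `n^(-1/2)` or less, into the main rate. The factor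
2 comes from `log d ≥ log 2 > 1/4`. -/
theorem scale_bounds {n d : ℕ} {ε ℓ H : ℝ} (hn : 2 ≤ n) (hd : 2 ≤ d) (hε : 0 < ε) (hε1 : ε < 1)
    (hH : 0 < H) (hHℓ : 1 ≤ H * ℓ) :
    1 ≤ (d : ℝ) * Real.log n ∧ 1 ≤ Real.sqrt H * Real.sqrt ℓ ∧
    (Real.sqrt n)⁻¹ ≤ 2 * Real.sqrt H *
      (d * Real.log n * Real.sqrt ℓ * Real.sqrt (Real.log d / (n * ε ^ 2))) := by
  have hn' : (2 : ℝ) ≤ n := by exact_mod_cast hn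
  have hd' : (2 : ℝ) ≤ d := by exact_mod_cast hd
  have hl2 := Real.log_two_gt_d9
  have hln : Real.log 2 ≤ Real.log n := Real.log_le_log two_pos hn'
  have hld : Real.log 2 ≤ Real.log d := Real.log_le_log two_pos hd'
  have h1 : 1 ≤ (d : ℝ) * Real.log n := by nlinarith
  have h2 : 1 ≤ Real.sqrt H * Real.sqrt ℓ := by
    rw [← Real.sqrt_mul hH.le]
    exact Real.one_le_sqrt.2 hHℓ
  refine ⟨h1, h2, ?_⟩
  have h3 : (Real.sqrt n)⁻¹ ≤ 2 * Real.sqrt (Real.log d / (n * ε ^ 2)) := by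
    have h4 : (2 : ℝ) = Real.sqrt 4 := by
      rw [show (4 : ℝ) = 2 ^ 2 by norm_num, Real.sqrt_sq two_pos.le]
    rw [h4, ← Real.sqrt_inv, ← Real.sqrt_mul (by norm_num)]
    refine Real.sqrt_le_sqrt ?_
    rw [← mul_div_assoc, inv_eq_one_div, div_le_div_iff₀ (by positivity) (by positivity)]
    have h5 : ε ^ 2 ≤ 1 := pow_le_one₀ hε.le hε1.le
    nlinarith
  have h0 : 0 ≤ Real.sqrt (Real.log d / (n * ε ^ 2)) := Real.sqrt_nonneg _
  calc (Real.sqrt n)⁻¹ ≤ 2 * Real.sqrt (Real.log d / (n * ε ^ 2)) := h3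
    _ ≤ (Real.sqrt H * Real.sqrt ℓ) * (d * Real.log n) *
        (2 * Real.sqrt (Real.log d / (n * ε ^ 2))) :=
        le_mul_of_one_le_left (by positivity) (one_le_mul_of_one_le_of_one_le h2 h1)
    _ = _ := by ring

theorem failure_probability_le {d : ℕ} {c : ℝ} (hd : 2 ≤ d) :
    4 * ((d : ℝ) ^ 2 + d) * Real.exp (-((c + 6) * Real.log d)) ≤ (d : ℝ) ^ (-c) := by
  have hd' : (2 : ℝ) ≤ d := by exact_mod_cast hd
  have hd0 : (0 : ℝ) < d := by linarith
  have h1 : Real.exp (-((c + 6) * Real.log d)) = (d : ℝ) ^ (-c) * ((d : ℝ) ^ 6)⁻¹ := by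
    rw [← Real.rpow_natCast, ← Real.rpow_neg hd0.le, ← Real.rpow_add hd0,
      Real.rpow_def_of_pos hd0]
    congr 1
    push_cast
    ring
  have h2 : 4 * ((d : ℝ) ^ 2 + d) ≤ (d : ℝ) ^ 6 := by
    have h3 : (2 : ℝ) ^ 4 ≤ (d : ℝ) ^ 4 := by gcongr
    have h4 : (d : ℝ) ^ 6 = (d : ℝ) ^ 4 * (d : ℝ) ^ 2 := by ring
    rw [h4]
    nlinarith
  rw [h1]
  calc 4 * ((d : ℝ) ^ 2 + d) * ((d : ℝ) ^ (-c) * ((d : ℝ) ^ 6)⁻¹)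
      ≤ (d : ℝ) ^ 6 * ((d : ℝ) ^ (-c) * ((d : ℝ) ^ 6)⁻¹) := by gcongr
    _ = (d : ℝ) ^ (-c) := by field_simp

/-! ### Calibration of the clipping and noise levels -/

/-- For `a ≥ 4` the exponents `a² log n / 8` and `a² log n / 4` are at least `2 log n` and `log n`.
The matrix needs `n⁻²` because its bias carries a factor `d`, which is at most `n`. -/
theorem gaussian_tail_at_log_le {n a σ : ℝ} (hn : 1 ≤ n) (ha : 4 ≤ a) (hσ : 0 < σ) :
    Real.exp (3 / 2 - (a * (σ * Real.sqrt (Real.log n)) / Real.sqrt 2 / σ) ^ 2 / 4)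
      ≤ Real.exp (3 / 2) * (n⁻¹ * n⁻¹) ∧
    Real.exp (3 / 2 - (a * (σ * Real.sqrt (Real.log n)) / σ) ^ 2 / 4)
      ≤ Real.exp (3 / 2) * n⁻¹ := by
  have hl : 0 ≤ Real.log n := Real.log_nonneg hn
  have hn0 : 0 < n := by linarith
  have hinv : n⁻¹ = Real.exp (-Real.log n) := by rw [Real.exp_neg, Real.exp_log hn0]
  have hs := Real.sq_sqrt hl
  have h2 := Real.sq_sqrt (zero_le_two (α := ℝ))
  have ha2 : 16 ≤ a ^ 2 := by nlinarith
  rw [hinv, ← Real.exp_add, ← Real.exp_add, ← Real.exp_add, Real.exp_le_exp, Real.exp_le_exp]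
  constructor
  · have : (a * (σ * Real.sqrt (Real.log n)) / Real.sqrt 2 / σ) ^ 2 = a ^ 2 * Real.log n / 2 := by
      rw [div_pow, div_pow, mul_pow, mul_pow, hs, h2]
      field_simp
    rw [this]
    nlinarith
  · have : (a * (σ * Real.sqrt (Real.log n)) / σ) ^ 2 = a ^ 2 * Real.log n := by
      rw [div_pow, mul_pow, mul_pow, hs]
      field_simp
    rw [this]
    nlinarith

/-- With `δ` bounded away from 1, `log(1/δ)` is bounded below, so additive constants are absorbed
into a multiple of it. -/
theorem log_div_bounds {δ δ₁ : ℝ} (hδ : 0 < δ) (h : δ ≤ δ₁) (h1 : δ₁ < 1) :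
    0 < Real.log (1 / δ) ∧ 1 ≤ (1 + (Real.log (1 / δ₁))⁻¹) * Real.log (1 / δ) ∧
    0 < Real.log (2.5 / δ) ∧
    Real.log (2.5 / δ) ≤ (1 + (Real.log (1 / δ₁))⁻¹) * Real.log (1 / δ) := by
  have hδ₁ : 0 < δ₁ := hδ.trans_le h
  have h0 : 0 < Real.log (1 / δ₁) := Real.log_pos ((one_lt_div hδ₁).2 h1)
  have hle : Real.log (1 / δ₁) ≤ Real.log (1 / δ) :=
    Real.log_le_log (by positivity) (by gcongr)
  have hquot : 1 ≤ (Real.log (1 / δ₁))⁻¹ * Real.log (1 / δ) := by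
    rwa [inv_mul_eq_div, one_le_div h0]
  have h25 : Real.log 2.5 ≤ 1 := by
    rw [Real.log_le_iff_le_exp (by norm_num)]
    linarith [Real.exp_one_gt_d9]
  have h25' : 0 < Real.log 2.5 := Real.log_pos (by norm_num)
  have hsplit : Real.log (2.5 / δ) = Real.log 2.5 + Real.log (1 / δ) := by
    rw [Real.log_div (by norm_num) hδ.ne', Real.log_div one_ne_zero hδ.ne', Real.log_one]
    ring
  refine ⟨by linarith, by linarith, by linarith, by linarith⟩

/-- The noise level of the algorithm dominates both sub-Gaussian fluctuations. -/
theorem variance_bounds {n A ε ℓ l2 H T D : ℝ} (hn : 0 < n) (hε : 0 < ε) (hε1 : ε < 1)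
    (hT : 0 < T) (hD : 0 < D) (hH : 0 < H) (hℓ : 0 < ℓ) (hHℓ : 1 ≤ H * ℓ) (hl2 : l2 ≤ H * ℓ) :
    2 * A ^ 2 * (T * D) ≤
      n * (8 * A * Real.sqrt (T * H) * Real.sqrt ℓ * Real.sqrt (D / (n * ε ^ 2))) ^ 2 ∧
    2 * (32 * A ^ 2 * l2 / ε ^ 2) * (T * D) ≤
      n * (8 * A * Real.sqrt (T * H) * Real.sqrt ℓ * Real.sqrt (D / (n * ε ^ 2))) ^ 2 := by
  -- Since `8² = 2 · 32`, the factor 8 matches the Gaussian noise variance exactly.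
  have hr : n * (8 * A * Real.sqrt (T * H) * Real.sqrt ℓ * Real.sqrt (D / (n * ε ^ 2))) ^ 2
      = 64 * A ^ 2 * (T * D) * (H * ℓ) / ε ^ 2 := by
    simp only [mul_pow]
    rw [Real.sq_sqrt (by positivity), Real.sq_sqrt hℓ.le, Real.sq_sqrt (by positivity)]
    field_simp
    ring
  have hA : 0 ≤ A ^ 2 * (T * D) := by positivity
  rw [hr]
  constructor
  · rw [le_div_iff₀ (by positivity)]
    have : ε ^ 2 ≤ 1 := pow_le_one₀ hε.le hε1.le
    calc 2 * A ^ 2 * (T * D) * ε ^ 2 ≤ 2 * A ^ 2 * (T * D) * 1 := by gcongr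
      _ ≤ 64 * A ^ 2 * (T * D) * 1 := by nlinarith
      _ ≤ 64 * A ^ 2 * (T * D) * (H * ℓ) := by gcongr
  · have : 2 * (32 * A ^ 2 * l2 / ε ^ 2) * (T * D) = 64 * A ^ 2 * (T * D) * l2 / ε ^ 2 := by ring
    rw [this]
    gcongr

/-- Total error of the released matrix: fluctuations and clipping bias. -/
theorem matrix_error_le {n d a σ ℓ g T H : ℝ} (hn : 1 ≤ n) (hd : 0 ≤ d) (hdn : d ≤ n)
    (hln : 0 ≤ Real.log n)
    (hscale : (Real.sqrt n)⁻¹ ≤ 2 * Real.sqrt H * (d * Real.log n * Real.sqrt ℓ * g)) :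
    2 * (8 * (a * (σ * Real.sqrt (d * Real.log n))) ^ 2 * Real.sqrt (T * H) * Real.sqrt ℓ * g)
      + 2 * (d * (4 * σ ^ 2 * (Real.exp (3 / 2) * (n⁻¹ * n⁻¹))))
    ≤ (16 * a ^ 2 * σ ^ 2 * Real.sqrt (T * H) + 16 * σ ^ 2 * Real.exp (3 / 2) * Real.sqrt H)
      * (d * Real.log n * Real.sqrt ℓ * g) := by
  have hn0 : 0 < n := by linarith
  have h1 : (a * (σ * Real.sqrt (d * Real.log n))) ^ 2 = a ^ 2 * σ ^ 2 * (d * Real.log n) := by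
    rw [mul_pow, mul_pow, Real.sq_sqrt (by positivity)]
    ring
  have h2 : d * n⁻¹ ≤ 1 := by rwa [← div_eq_mul_inv, div_le_one hn0]
  have h3 : n⁻¹ ≤ (Real.sqrt n)⁻¹ := by
    refine inv_anti₀ (by positivity) (Real.sqrt_le_iff.2 ⟨hn0.le, ?_⟩)
    nlinarith
  have h4 : d * n⁻¹ * n⁻¹ ≤ 2 * Real.sqrt H * (d * Real.log n * Real.sqrt ℓ * g) :=
    (mul_le_of_le_one_left (by positivity) h2).trans (h3.trans hscale)
  have h5 : 2 * (d * (4 * σ ^ 2 * (Real.exp (3 / 2) * (n⁻¹ * n⁻¹))))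
      = 8 * σ ^ 2 * Real.exp (3 / 2) * (d * n⁻¹ * n⁻¹) := by ring
  have h6 := mul_le_mul_of_nonneg_left h4
    (show 0 ≤ 8 * σ ^ 2 * Real.exp (3 / 2) by positivity)
  rw [h5, h1]
  linarith

/-- Total error of the released vector: fluctuations and truncation bias. -/
theorem vector_error_le {n d a σ ℓ g γ B τ₂ s W T H : ℝ} (hn : 1 ≤ n)
    (ha : 0 ≤ a) (hσ : 0 < σ) (hs : 0 ≤ s) (hW : 0 ≤ W)
    (hln : 0 ≤ Real.log n) (hdl : 1 ≤ d * Real.log n) (hd1 : 1 ≤ d) (hg : 0 ≤ g) (hgγ : g ≤ γ)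
    (hBg : B * g = γ) (hτ₂ : τ₂ ≤ s * B) (hHℓ : 1 ≤ Real.sqrt H * Real.sqrt ℓ)
    (hscale : (Real.sqrt n)⁻¹ ≤ 2 * Real.sqrt H * (d * Real.log n * Real.sqrt ℓ * g)) :
    2 * (8 * (a * (σ * Real.sqrt (Real.log n)) * τ₂ * Real.sqrt d) * Real.sqrt (T * H)
        * Real.sqrt ℓ * g)
      + (Real.sqrt n * (4 * σ ^ 2 * (Real.exp (3 / 2) * n⁻¹))
        + ((Real.sqrt n)⁻¹ + a * (σ * Real.sqrt (Real.log n)) * γ) * W)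
    ≤ (16 * a * σ * s * Real.sqrt (T * H) + (4 * σ ^ 2 * Real.exp (3 / 2) + W) * (2 * Real.sqrt H)
        + a * σ * W * Real.sqrt H) * (d * Real.log n * Real.sqrt ℓ * γ) := by
  have hn0 : 0 < n := by linarith
  have hγ : 0 ≤ γ := hg.trans hgγ
  have hsl : Real.sqrt (Real.log n) * Real.sqrt d ≤ d * Real.log n := by
    rw [← Real.sqrt_mul hln, mul_comm]
    exact Real.sqrt_le_iff.2 ⟨by linarith, by nlinarith⟩
  have hsl' : Real.sqrt (Real.log n) ≤ d * Real.log n :=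
    (le_mul_of_one_le_right (Real.sqrt_nonneg _) (Real.one_le_sqrt.2 hd1)).trans hsl
  have h1 : 2 * (8 * (a * (σ * Real.sqrt (Real.log n)) * τ₂ * Real.sqrt d) * Real.sqrt (T * H)
        * Real.sqrt ℓ * g)
      ≤ 16 * a * σ * s * Real.sqrt (T * H) * (d * Real.log n * Real.sqrt ℓ * γ) := by
    have hsγ : τ₂ * g ≤ s * γ := by
      rw [← hBg, ← mul_assoc]
      gcongr
    calc 2 * (8 * (a * (σ * Real.sqrt (Real.log n)) * τ₂ * Real.sqrt d) * Real.sqrt (T * H)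
          * Real.sqrt ℓ * g)
        = 16 * a * σ * Real.sqrt (T * H) * Real.sqrt ℓ
          * (Real.sqrt (Real.log n) * Real.sqrt d) * (τ₂ * g) := by ring
      _ ≤ 16 * a * σ * Real.sqrt (T * H) * Real.sqrt ℓ
          * (Real.sqrt (Real.log n) * Real.sqrt d) * (s * γ) := by gcongr
      _ ≤ 16 * a * σ * Real.sqrt (T * H) * Real.sqrt ℓ * (d * Real.log n) * (s * γ) := by
          gcongr
      _ = _ := by ring
  have hscale' : (Real.sqrt n)⁻¹ ≤ 2 * Real.sqrt H * (d * Real.log n * Real.sqrt ℓ * γ) :=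
    hscale.trans (by gcongr)
  have h2 : Real.sqrt n * (4 * σ ^ 2 * (Real.exp (3 / 2) * n⁻¹))
      = 4 * σ ^ 2 * Real.exp (3 / 2) * (Real.sqrt n)⁻¹ := by
    have : Real.sqrt n * n⁻¹ = (Real.sqrt n)⁻¹ := by
      rw [← div_eq_mul_inv, Real.sqrt_div_self', one_div]
    rw [← this]
    ring
  have h3 : (4 * σ ^ 2 * Real.exp (3 / 2) + W) * (Real.sqrt n)⁻¹
      ≤ (4 * σ ^ 2 * Real.exp (3 / 2) + W)
        * (2 * Real.sqrt H * (d * Real.log n * Real.sqrt ℓ * γ)) :=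
    mul_le_mul_of_nonneg_left hscale' (by positivity)
  have h4 : a * (σ * Real.sqrt (Real.log n)) * γ * W
      ≤ a * σ * W * Real.sqrt H * (d * Real.log n * Real.sqrt ℓ * γ) := by
    calc a * (σ * Real.sqrt (Real.log n)) * γ * W
        = a * σ * W * (1 * Real.sqrt (Real.log n) * γ) := by ring
      _ ≤ a * σ * W * ((Real.sqrt H * Real.sqrt ℓ) * (d * Real.log n) * γ) := by gcongr
      _ = _ := by ring
  rw [h2]
  linarith

/-! ### Assembly of the probability bound -/

theorem runLaw_error_le {n d k : ℕ} {P : Measure (Vec d × ℝ)} [IsProbabilityMeasure P]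
    {θ : Vec d} {a₁ a₂ σ κ κx M p s c ε δ δ₁ τ₂ B g γ T H K₁ K₂ : ℝ} {q : Params}
    (hn : 2 ≤ n) (hd : 2 ≤ d) (hσ : 0 < σ) (hκ : 0 < κ) (hp : 1 < p) (ha₁ : 4 ≤ a₁) (ha₂ : 4 ≤ a₂)
    (hs : 0 ≤ s) (hc : 0 < c) (hε : 0 < ε) (hε1 : ε < 1) (hδ : 0 < δ) (hδ₁ : δ ≤ δ₁) (hδ₁' : δ₁ < 1)
    (hm : IsSparseLinearModel P θ k) (hw : IsWellConditioned P θ κ κx)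
    (ht : IsHeavyTailed P σ p M)
    (hB : B = ((n : ℝ) * ε ^ 2 / Real.log d) ^ (1 / (2 * p)))
    (hg : g = Real.sqrt (Real.log d / (n * ε ^ 2)))
    (hγ : γ = (Real.log d / (n * ε ^ 2)) ^ ((p - 1) / (2 * p)))
    (hτ : B ≤ τ₂) (hτ' : τ₂ ≤ s * B)
    (hT : T = c + 6) (hH : H = 1 + (Real.log (1 / δ₁))⁻¹)
    (hK₁ : K₁ = 16 * a₂ ^ 2 * σ ^ 2 * Real.sqrt (T * H)
      + 16 * σ ^ 2 * Real.exp (3 / 2) * Real.sqrt H)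
    (hK₂ : K₂ = 16 * a₁ * σ * s * Real.sqrt (T * H)
      + (4 * σ ^ 2 * Real.exp (3 / 2) + (1 + |M|)) * (2 * Real.sqrt H)
        + a₁ * σ * (1 + |M|) * Real.sqrt H)
    (hsize : (4 * K₁ ^ 2 / κ + κ) * Real.log ((n : ℝ) * d / δ) ^ 4
      * ((d : ℝ) ^ 4 / (ε ^ 2 * κ)) ≤ n)
    (hqε : q.eps = ε) (hqδ : q.del = δ) (hqr : q.r = a₂ * (σ * Real.sqrt (d * Real.log n)))
    (hq₁ : q.tau1 = a₁ * (σ * Real.sqrt (Real.log n))) (hq₂ : q.tau2 = τ₂)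
    (hlam : 2 / κ * (K₁ + K₂) * (d * Real.log n * Real.sqrt (Real.log (1 / δ)) * γ) ≤ q.lam) :
    runLaw n P q {ω | 2 * q.lam * Real.sqrt k < ‖thetaPriv q ω.1 ω.2 - θ‖}
      ≤ ENNReal.ofReal ((d : ℝ) ^ (-c)) := by
  have hn' : (2 : ℝ) ≤ n := by exact_mod_cast hn
  have hd' : (2 : ℝ) ≤ d := by exact_mod_cast hd
  have hn0 : (0 : ℝ) < n := by linarith
  have hd0 : (0 : ℝ) < d := by linarith
  have hln : 0 < Real.log n := Real.log_pos (by linarith)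
  have hld : 0 < Real.log d := Real.log_pos (by linarith)
  obtain ⟨hℓ0, hHℓ, hlog0, hlog⟩ := log_div_bounds hδ hδ₁ hδ₁'
  rw [← hH] at hHℓ hlog
  set ℓ := Real.log (1 / δ) with hℓ
  have hH0 : 0 < H := by
    by_contra hcon
    linarith [mul_nonpos_of_nonpos_of_nonneg (not_lt.1 hcon) hℓ0.le]
  have hT0 : 0 < T := by linarith
  obtain ⟨hdE, hK₁small⟩ := sample_size_bounds hn hd hε hδ (hδ₁.trans_lt hδ₁') hκ hsize
  rw [← hℓ, ← hg] at hK₁small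
  obtain ⟨hdl, hHs, hscale⟩ := scale_bounds hn hd hε hε1 hH0 hHℓ
  rw [← hg] at hscale
  have hdn : (d : ℝ) ≤ n := by
    exact hdE.trans (mul_le_of_le_one_right hn0.le (pow_le_one₀ hε.le hε1.le))
  obtain ⟨hgγ, hBg, hBp⟩ := rate_identities hld ((Real.log_le_self hd0.le).trans hdE) hp
  rw [← hg, ← hγ] at hgγ
  rw [← hB, ← hg, ← hγ] at hBg
  rw [← hB, ← hγ] at hBp
  have hB0 : 0 < B := by rw [hB]; positivity
  have hg0 : 0 ≤ g := by rw [hg]; positivity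
  have hγ0 : 0 ≤ γ := hg0.trans hgγ
  have hτ₂0 : 0 < τ₂ := hB0.trans_le hτ
  have hr0 : 0 < q.r := by rw [hqr]; positivity
  have h10 : 0 < q.tau1 := by rw [hq₁]; positivity
  have h20 : 0 < q.tau2 := hq₂ ▸ hτ₂0
  set η := 8 * q.r ^ 2 * Real.sqrt (T * H) * Real.sqrt ℓ * g with hη
  -- The factor `√d` comes from the `d` in the variance of the vector noise; the bounded data
  -- products do not need it.
  set ξ := 8 * (q.tau1 * q.tau2 * Real.sqrt d) * Real.sqrt (T * H) * Real.sqrt ℓ * g with hξ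
  obtain ⟨v₁, v₂⟩ := variance_bounds (A := q.r ^ 2) hn0 hε hε1 hT0 hld hH0 hℓ0 hHℓ hlog
  obtain ⟨v₃, v₄⟩ := variance_bounds (A := q.tau1 * q.tau2 * Real.sqrt d) hn0 hε hε1 hT0 hld hH0
    hℓ0 hHℓ hlog
  rw [← hg] at v₁ v₂ v₃ v₄
  have hA : (q.tau1 * q.tau2 * Real.sqrt d) ^ 2 = q.tau1 ^ 2 * q.tau2 ^ 2 * d := by
    rw [mul_pow, mul_pow, Real.sq_sqrt hd0.le]
  have htyp := runLaw_not_isTypical_le (P := P) (q := q) (η := η) (ξ := ξ)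
    (t := T * Real.log d) (n := n) (by omega) (by positivity) (by positivity) hr0 h10 h20
    (by rw [hqδ, hqε]; positivity) (by rw [hqδ, hqε]; positivity) v₁
    (by
      rw [hqδ, hqε]
      refine le_of_eq_of_le ?_ v₂
      ring)
    (by
      refine le_trans ?_ v₃
      have hle : (q.tau1 * q.tau2) ^ 2 ≤ (q.tau1 * q.tau2 * Real.sqrt d) ^ 2 := by
        rw [hA, mul_pow]
        exact le_mul_of_one_le_right (by positivity) (by linarith)
      gcongr)
    (by
      rw [hqδ, hqε]
      refine le_of_eq_of_le ?_ v₄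
      rw [hA]
      ring)
  refine (measure_mono fun ω hω => ?_).trans (htyp.trans (ENNReal.ofReal_le_ofReal ?_))
  · intro hgood
    obtain ⟨t₂, t₁⟩ := gaussian_tail_at_log_le (n := (n : ℝ)) (a := a₂) (by linarith) ha₂ hσ
    obtain ⟨-, t₁⟩ := gaussian_tail_at_log_le (n := (n : ℝ)) (a := a₁) (by linarith) ha₁ hσ
    have hXX := matrix_error_le (a := a₂) (σ := σ) (T := T) (by linarith) hd0.le hdn hln.le hscale
    have hXY := vector_error_le (a := a₁) (σ := σ) (T := T) (W := 1 + |M|) (by linarith)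
      (by linarith) hσ hs (by positivity) hln.le hdl (by linarith) hg0 hgγ hBg hτ' hHs hscale
    rw [← hK₁, ← hqr] at hXX
    rw [← hK₂, ← hq₁, ← hq₂] at hXY
    rw [← hη] at hXX
    rw [← hξ] at hXY
    refine absurd (norm_thetaPriv_sub_le_of_isTypical (by omega) hκ hm hw hgood
      (β := 2 * (d * (4 * σ ^ 2 * (Real.exp (3 / 2) * ((n : ℝ)⁻¹ * (n : ℝ)⁻¹)))))
      (γ := Real.sqrt n * (4 * σ ^ 2 * (Real.exp (3 / 2) * (n : ℝ)⁻¹))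
        + ((Real.sqrt n)⁻¹ + q.tau1 * γ) * (1 + |M|))
      (fun a b => ?_) (fun j => ?_) (hXX.trans hK₁small) (le_trans ?_ hlam)) (not_le.2 hω)
    · refine (abs_integral_clip_mul_clip_sub_covMat_le hm ht hσ
        (τ := a₂ * (σ * Real.sqrt (Real.log n)) / Real.sqrt 2) hr0.le (by positivity) ?_ a b).trans
        (by gcongr)
      rw [hqr, div_pow, mul_pow, mul_pow, mul_pow, mul_pow, Real.sq_sqrt (by positivity),
        Real.sq_sqrt hln.le, Real.sq_sqrt two_pos.le]
      ring
    -- The weight `√n` balances `s · n⁻¹` against `s⁻¹`; the truncation term becomes `τ₁γ` because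
    -- `B^(p-1) = γ⁻¹`.
    · refine (abs_integral_shrink_mul_shrink_sub_le hm ht hσ hp h10.le hB0 (hq₂ ▸ hτ)
        (Real.sqrt_pos.2 hn0) j).trans ?_
      rw [hBp, div_inv_eq_mul]
      rw [← hq₁] at t₁
      gcongr
    -- Invertibility used the matrix error at the faster rate `g`; here it only has to join the
    -- vector error at the slower rate `γ`.
    · have hQR : K₁ * (d * Real.log n * Real.sqrt ℓ * g)
          ≤ K₁ * (d * Real.log n * Real.sqrt ℓ * γ) := by
        rw [hK₁]
        gcongr
      rw [mul_assoc (2 / κ)]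
      gcongr
      linarith
  · rw [hT]
    exact failure_probability_le hd

end LDPSparse

end

theorem mainTheorem6 :
    ∃ a₀ > (0 : ℝ), ∃ m : ℕ,
      ∀ a₁ ≥ a₀, ∀ a₂ ≥ a₀,
      ∀ σ κinf κx M p δ₀ s c : ℝ, 0 < σ → 0 < κinf → 0 < κx → 1 < p → δ₀ < 1 → 1 ≤ s → 0 < c →
      ∃ b₀ > (0 : ℝ), ∀ b ≥ b₀, ∃ C > (0 : ℝ), ∃ Cn > (0 : ℝ),
      ∀ (n d k : ℕ) (ε δ τ₂ : ℝ), 2 ≤ n → 2 ≤ d → 0 < ε → ε < 1 → 0 < δ → δ ≤ δ₀ →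
        ((n : ℝ) * ε ^ 2 / Real.log d) ^ (1 / (2 * p)) ≤ τ₂ →
        τ₂ ≤ s * ((n : ℝ) * ε ^ 2 / Real.log d) ^ (1 / (2 * p)) →
      ∀ (θ : LDPSparse.Vec d) (P : Measure (LDPSparse.Vec d × ℝ)), IsProbabilityMeasure P →
        LDPSparse.IsSparseLinearModel P θ k →
        LDPSparse.IsWellConditioned P θ κinf κx →
        LDPSparse.IsHeavyTailed P σ p M →
        Cn * Real.log ((n : ℝ) * d / δ) ^ m *
            max ((d : ℝ) ^ 4 / (ε ^ 2 * κinf))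
              (LDPSparse.specNorm (LDPSparse.covMat P) ^ 4 * (d : ℝ) ^ 3 /
                (ε ^ 2 * LDPSparse.lamMin (LDPSparse.covMat P) ^ 2)) ≤ (n : ℝ) →
      ∀ q : LDPSparse.Params,
        q = { eps := ε
              del := δ
              r := a₂ * (σ * Real.sqrt (d * Real.log n))
              tau1 := a₁ * (σ * Real.sqrt (Real.log n))
              tau2 := τ₂
              lam := b * (d * Real.log n * Real.sqrt (Real.log (1 / δ)) *
                (Real.log d / (n * ε ^ 2)) ^ ((p - 1) / (2 * p))) } →
        LDPSparse.runLaw n P q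
          {ω | C * (d * Real.log n * Real.sqrt (k * Real.log (1 / δ)) *
                (Real.log d / (n * ε ^ 2)) ^ ((p - 1) / (2 * p)))
              < ‖LDPSparse.thetaPriv q ω.1 ω.2 - θ‖}
          ≤ ENNReal.ofReal ((d : ℝ) ^ (-c)) := by
  -- `a₀ = 4` makes the clipping tails at most a constant times `n⁻²`; `m = 4` counts the logarithms
  -- in `sample_size_bounds`.
  refine ⟨4, by norm_num, 4, ?_⟩
  intro a₁ ha₁ a₂ ha₂ σ κ κx M p δ₀ s c hσ hκ _ hp hδ₀ hs hc
  -- `δ₀` itself might be nonpositive; the maximum keeps `log(1/δ₁)` positive.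
  set δ₁ : ℝ := max δ₀ (1 / 2) with hδ₁
  have hδ₁0 : 0 < δ₁ := lt_max_of_lt_right (by norm_num)
  have hδ₁1 : δ₁ < 1 := max_lt hδ₀ (by norm_num)
  have hH0 : 0 < 1 + (Real.log (1 / δ₁))⁻¹ := by
    have : 0 < Real.log (1 / δ₁) := Real.log_pos ((one_lt_div hδ₁0).2 hδ₁1)
    positivity
  obtain ⟨H, hH⟩ : ∃ H, H = 1 + (Real.log (1 / δ₁))⁻¹ := ⟨_, rfl⟩
  obtain ⟨T, hT⟩ : ∃ T, T = c + 6 := ⟨_, rfl⟩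
  obtain ⟨K₁, hK₁⟩ : ∃ K₁, K₁ = 16 * a₂ ^ 2 * σ ^ 2 * Real.sqrt (T * H)
      + 16 * σ ^ 2 * Real.exp (3 / 2) * Real.sqrt H := ⟨_, rfl⟩
  obtain ⟨K₂, hK₂⟩ : ∃ K₂, K₂ = 16 * a₁ * σ * s * Real.sqrt (T * H)
      + (4 * σ ^ 2 * Real.exp (3 / 2) + (1 + |M|)) * (2 * Real.sqrt H)
        + a₁ * σ * (1 + |M|) * Real.sqrt H := ⟨_, rfl⟩
  rw [← hH] at hH0
  have hT0 : 0 < T := by linarith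
  have ha₁0 : 0 < a₁ := by linarith
  have ha₂0 : 0 < a₂ := by linarith
  have hK₁0 : 0 < K₁ := by rw [hK₁]; positivity
  have hK₂0 : 0 < K₂ := by rw [hK₂]; positivity
  -- `b₀` is the least factor for which `λ` is guaranteed to dominate the sup-norm error; `C = 2b`
  -- comes from the bound `2λ√k`.
  refine ⟨2 / κ * (K₁ + K₂), by positivity, fun b hb => ?_⟩
  have hb0 : 0 < b := lt_of_lt_of_le (by positivity) hb
  refine ⟨2 * b, by positivity, 4 * K₁ ^ 2 / κ + κ, by positivity, ?_⟩
  intro n d k ε δ τ₂ hn hd hε hε1 hδ hδδ₀ hτ hτ' θ P hP hm hw ht hsize q hq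
  have hδδ₁ : δ ≤ δ₁ := hδδ₀.trans (le_max_left _ _)
  have hln : 0 ≤ Real.log n := Real.log_natCast_nonneg n
  have hld : 0 ≤ Real.log d := Real.log_natCast_nonneg d
  have hlog0 : 0 ≤ Real.log ((n : ℝ) * d / δ) := by
    refine Real.log_nonneg ((one_le_div hδ).2 ?_)
    have hn' : (2 : ℝ) ≤ n := by exact_mod_cast hn
    have hd' : (2 : ℝ) ≤ d := by exact_mod_cast hd
    nlinarith
  have hlamq : q.lam = b * (d * Real.log n * Real.sqrt (Real.log (1 / δ)) *
      (Real.log d / (n * ε ^ 2)) ^ ((p - 1) / (2 * p))) := by rw [hq]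
  have hlam : 2 / κ * (K₁ + K₂) * (d * Real.log n * Real.sqrt (Real.log (1 / δ)) *
      (Real.log d / (n * ε ^ 2)) ^ ((p - 1) / (2 * p))) ≤ q.lam := by
    rw [hlamq]
    gcongr
  have key := LDPSparse.runLaw_error_le hn hd hσ hκ hp ha₁ ha₂ (by linarith) hc hε hε1 hδ hδδ₁ hδ₁1
    hm hw ht rfl rfl rfl hτ hτ' hT hH hK₁ hK₂
    (le_trans (by gcongr; exact le_max_left _ _) hsize)
    (by rw [hq]) (by rw [hq]) (by rw [hq]) (by rw [hq]) (by rw [hq]) hlam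
  refine le_of_eq_of_le ?_ key
  have heq : 2 * b * (d * Real.log n * Real.sqrt (k * Real.log (1 / δ)) *
      (Real.log d / (n * ε ^ 2)) ^ ((p - 1) / (2 * p))) = 2 * q.lam * Real.sqrt k := by
    rw [hlamq, Real.sqrt_mul (Nat.cast_nonneg k)]
    ring
  rw [heq]
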